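/- **Theorem 3.1 (Existence and uniqueness of the solution).** *Setting.* Let $(\Omega,\mathcal F,\mathbb P)$ be a probability space and $\xi=(\xi_1,\xi_2,\dots)$ a sequence of independent random variables uniformly distributed on $[-1,1]$. Let $p_0=1$, $p_1(x)=x$, $(n+1)p_{n+1}(x)=(2n+1)xp_n(x)-np_{n-1}(x)$ be the Legendre polynomials, let $\mathcal I$ be the set of sequences $\alpha=(\alpha_1,\alpha_2,\dots)$ of non-negative integers with finitely many nonzero terms, and let $L_\alpha=\prod_i p_{\alpha_i}(\xi_i)$ for $\alpha\in\mathcal I$. Let $X$ be a Banach space and $T>0$. An element of $X\otimes(L)^2$ is a chaos expansion $\sum_\alpha f_\alpha L_\alpha$ with $f_\alpha\in X$ and $\sum_\alpha\|f_\alpha\|_X^2\,\mathbb E L_\alpha^2<\infty$. An element of $C([0,T],X)\otimes(L)^2$, respectively $C^1([0,T],X)\otimes(L)^2$, is a chaos expansion $u=\sum_\alpha u_\alpha L_\alpha$ with $u_\alpha\in C([0,T],X)$, respectively $u_\alpha\in C^1([0,T],X)$, for all $\alpha$ and $\sum_\alpha\|u_\alpha\|^2\,\mathbb E L_\alpha^2<\infty$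 for the corresponding norm, $\|u_\alpha\|_{C^1([0,T],X)}^2=\sup_{[0,T]}\|u_\alpha\|_X^2+\sup_{[0,T]}\|u_\alpha'\|_X^2$. Further, $u\in C^1((0,T],X)\otimes(L)^2$ means $u_\alpha\in C^1((0,T],X)$ for all $\alpha$ and $\sum_\alpha\|u_\alpha\|_{C^1([\varepsilon,T],X)}^2\,\mathbb E L_\alpha^2<\infty$ for every $0<\varepsilon<T$. Time derivatives are taken coordinatewise. *Assumptions.* (A1) $\mathcal L$ is a linear operator with domain $\mathcal D(\mathcal L)$ dense in $X$ that acts coordinatewise, $\mathcal L\big(\sum_\alpha f_\alpha L_\alpha\big)=\sum_\alpha \mathcal L(f_\alpha)L_\alpha$, and it is the infinitesimal generator of a $C_0$ semigroup $(S_t)_{t\ge0}$ on $X$ of type $(M,w)$, i.e. $\|S_t\|\le Me^{wt}$ for $t\ge0$, for some $M>0$, $w\in\mathbb R$. (A2) $u^0=\sum_\alpha u^0_\alpha L_\alpha$ satisfies $u^0_\alpha\in\mathcal D(\mathcal L)$ for all $\alpha$, $\sum_\alpha\|u^0_\alpha\|_X^2\,\mathbb E L_\alpha^2<\infty$ and $\sum_\alpha\|\mathcal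 L u^0_\alpha\|_X^2\,\mathbb E L_\alpha^2<\infty$. (A3) $G=\sum_\alpha g_\alpha L_\alpha\in C^1([0,T],X)\otimes(L)^2$. *Claim.* The stochastic Cauchy problem $$u_t(t,\omega)=\mathcal L u(t,\omega)+G(t,\omega),\qquad u(0,\omega)=u^0(\omega)$$ has exactly one classical solution, that is, exactly one $u\in C([0,T],X)\otimes(L)^2\cap C^1((0,T],X)\otimes(L)^2$ with $u(0)=u^0$ that satisfies the equation at every $t\in(0,T]$. It is $$u(t)=\sum_{\alpha\in\mathcal I}u_\alpha(t)L_\alpha,\qquad u_\alpha(t)=S_tu^0_\alpha+\int_0^tS_{t-s}\,g_\alpha(s)\,ds ,$$ it belongs to $C^1([0,T],X)\otimes(L)^2$, and it satisfies the equation at every $t\in[0,T]$. For a general Banach space $X$ the chaos expansions are understood through their coefficients. If $X$ is a Hilbert space, the same holds for $X$-valued processes: if the square integrable random variables $u^0$ and $G(t)$, $t\in[0,T]$, are the sums in $L^2(\Omega;X)$ of their chaos expansions, then there is a process $u$ with $u(t)=\sum_\alpha u_\alpha(t)L_\alpha$ in $L^2(\Omega;X)$ for all $t\in[0,T]$, $u_\alpha$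 as above, it satisfies the equation $\mathbb P$-almost surely at every $t\in[0,T]$ with $u(0)=u^0$ almost surely, it belongs to $C^1([0,T],X)\otimes(L)^2$, and every classical solution coincides with it almost surely at every $t\in[0,T]$. -/

import Mathlib

open Set Filter Topology MeasureTheory ProbabilityTheory
open scoped ENNReal

noncomputable section

namespace ChaosCauchy

/-! ### Fourier-Legendre polynomials -/

/-- The Legendre polynomials on `[-1, 1]`, through their three-term recursion
`(n+1) p_{n+1}(x) = (2n+1) x p_n(x) - n p_{n-1}(x)`. -/
def legendreP : ℕ → ℝ → ℝ
  | 0, _ => 1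
  | 1, x => x
  | n + 2, x =>
      ((2 * (n : ℝ) + 3) * x * legendreP (n + 1) x - ((n : ℝ) + 1) * legendreP n x) / ((n : ℝ) + 2)

/-- Sequences of non-negative integers with finitely many nonzero components. -/
abbrev MultiIndex : Type := ℕ →₀ ℕ

variable {Ω : Type*} [MeasurableSpace Ω] {X : Type*} [NormedAddCommGroup X] [NormedSpace ℝ X]

/-- A sequence of independent random variables, each uniformly distributed on `[-1, 1]`. -/
structure IsUniformSequence (ξ : ℕ → Ω → ℝ) (P : Measure Ω) : Prop where
  measurable : ∀ i, Measurable (ξ i)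
  indep : iIndepFun ξ P
  uniform : ∀ i, pdf.IsUniform (ξ i) (Icc (-1 : ℝ) 1) P volume

/-- The Fourier-Legendre polynomial `L_α(ξ(ω)) = ∏ i, p_{α_i}(ξ_i(ω))`; the factors with
`α_i = 0` equal `1`, so the product runs over the support of `α`. -/
def fourierLegendre (ξ : ℕ → Ω → ℝ) (α : MultiIndex) (ω : Ω) : ℝ :=
  α.prod fun i n => legendreP n (ξ i ω)

/-- The second moment `𝔼 L_α²`. -/
def secondMoment (ξ : ℕ → Ω → ℝ) (P : Measure Ω) (α : MultiIndex) : ℝ :=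
  ∫ ω, fourierLegendre ξ α ω ^ 2 ∂P

/-! ### Spaces of chaos expansions, in terms of the coefficients

Here `w α` stands for the weight `𝔼 L_α²`. -/

/-- `sup_{t ∈ K} ‖f t‖`. -/
def supNorm (K : Set ℝ) (f : ℝ → X) : ℝ := ⨆ t : K, ‖f t‖

/-- The time derivative on `[0, T]` (one-sided at the end points). -/
def timeDeriv (T : ℝ) (f : ℝ → X) : ℝ → X := derivWithin f (Icc 0 T)

/-- The coefficients of an element of `X ⊗ (L)²`. -/
def MemX (w : MultiIndex → ℝ) (f : MultiIndex → X) : Prop :=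
  Summable fun α => ‖f α‖ ^ 2 * w α

/-- The coefficients of an element of `C([0,T], X) ⊗ (L)²`. -/
def MemC (w : MultiIndex → ℝ) (T : ℝ) (u : MultiIndex → ℝ → X) : Prop :=
  (∀ α, ContinuousOn (u α) (Icc 0 T)) ∧
    Summable fun α => supNorm (Icc 0 T) (u α) ^ 2 * w α

/-- The coefficients of an element of `C¹([0,T], X) ⊗ (L)²`, where
`‖f‖²_{C¹([0,T],X)} = sup ‖f‖² + sup ‖f'‖²`. -/
def MemC1 (w : MultiIndex → ℝ) (T : ℝ) (u : MultiIndex → ℝ → X) : Prop :=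
  (∀ α, ContDiffOn ℝ 1 (u α) (Icc 0 T)) ∧
    Summable fun α =>
      (supNorm (Icc 0 T) (u α) ^ 2 + supNorm (Icc 0 T) (timeDeriv T (u α)) ^ 2) * w α

/-- The coefficients of an element of `C¹((0,T], X) ⊗ (L)²`: the interval is not compact, so the
`C¹`-norms are square summable on `[ε, T]` for every `0 < ε < T`. -/
def MemC1Ioc (w : MultiIndex → ℝ) (T : ℝ) (u : MultiIndex → ℝ → X) : Prop :=
  (∀ α, ContDiffOn ℝ 1 (u α) (Ioc 0 T)) ∧
    ∀ ε ∈ Ioo 0 T, Summable fun α =>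
      (supNorm (Icc ε T) (u α) ^ 2 + supNorm (Icc ε T) (timeDeriv T (u α)) ^ 2) * w α

/-! ### Semigroups -/

/-- `(S t)_{t ≥ 0}` is a `C₀` semigroup of bounded linear operators (the values at negative times
play no role). -/
structure IsC0Semigroup (S : ℝ → X →L[ℝ] X) : Prop where
  zero : S 0 = ContinuousLinearMap.id ℝ X
  add : ∀ s t, 0 ≤ s → 0 ≤ t → S (s + t) = (S s).comp (S t)
  tendsto : ∀ x, Tendsto (fun t => S t x) (𝓝[>] 0) (𝓝 x)

/-- `𝓛`, with its domain, is the infinitesimal generator of `S`: `x ∈ D(𝓛)` and `𝓛 x = y` exactly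
when `(S h x - x) / h → y` as `h ↓ 0`. -/
def IsGenerator (𝓛 : X →ₗ.[ℝ] X) (S : ℝ → X →L[ℝ] X) : Prop :=
  ∀ x y : X, (x, y) ∈ 𝓛.graph ↔ Tendsto (fun h : ℝ => h⁻¹ • (S h x - x)) (𝓝[>] 0) (𝓝 y)

/-- The semigroup is of type `(M, w)`. -/
def IsOfType (S : ℝ → X →L[ℝ] X) (M w : ℝ) : Prop :=
  0 < M ∧ ∀ t, 0 ≤ t → ‖S t‖ ≤ M * Real.exp (w * t)

/-- The variation-of-constants formula for the coefficients. -/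
def variationOfConstants (S : ℝ → X →L[ℝ] X) (u₀ : MultiIndex → X) (g : MultiIndex → ℝ → X)
    (α : MultiIndex) (t : ℝ) : X :=
  S t (u₀ α) + ∫ s in (0 : ℝ)..t, S (t - s) (g α s)

/-! ### The Cauchy problem for chaos expansions `∑ u_α(t) L_α` given by their coefficients

The time derivative and `𝓛` act coordinatewise. -/

/-- `u_t = 𝓛 u + G` at time `t`: each `u_α(t)` lies in `D(𝓛)` and
`𝓛 u_α(t) = u_α'(t) - g_α(t)`. -/
def SatisfiesAt (𝓛 : X →ₗ.[ℝ] X) (T : ℝ) (g u : MultiIndex → ℝ → X) (t : ℝ) : Prop :=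
  ∀ α, (u α t, timeDeriv T (u α) t - g α t) ∈ 𝓛.graph

/-- Classical solutions of `u_t = 𝓛 u + G`, `u(0) = u⁰`, as chaos expansions. -/
structure IsClassicalSolution (w : MultiIndex → ℝ) (𝓛 : X →ₗ.[ℝ] X) (T : ℝ)
    (u₀ : MultiIndex → X) (g u : MultiIndex → ℝ → X) : Prop where
  memC : MemC w T u
  memC1 : MemC1Ioc w T u
  initial : ∀ α, u α 0 = u₀ α
  equation : ∀ t ∈ Ioc 0 T, SatisfiesAt 𝓛 T g u t

/-! ### The Cauchy problem for `X`-valued stochastic processes -/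

/-- The square integrable random variable `F` is the sum of the series `∑ f_α L_α(ξ)`, with
(unconditional) convergence in `L²(Ω; X)`. -/
def HasChaosExpansion (ξ : ℕ → Ω → ℝ) (P : Measure Ω) (F : Ω → X) (f : MultiIndex → X) : Prop :=
  MemLp F 2 P ∧
    Tendsto (fun s : Finset MultiIndex =>
      eLpNorm (fun ω => F ω - ∑ α ∈ s, fourierLegendre ξ α ω • f α) 2 P) atTop (𝓝 0)

/-- The process `U` has on the time set `J` the chaos expansion `U(t) = ∑ u_α(t) L_α(ξ)`. -/
def ProcHasChaosExpansion (ξ : ℕ → Ω → ℝ) (P : Measure Ω) (J : Set ℝ) (U : ℝ → Ω → X)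
    (u : MultiIndex → ℝ → X) : Prop :=
  ∀ t ∈ J, HasChaosExpansion ξ P (U t) (fun α => u α t)

/-- `U ∈ C([0,T], X) ⊗ (L)²`. -/
def ProcMemC (ξ : ℕ → Ω → ℝ) (P : Measure Ω) (T : ℝ) (U : ℝ → Ω → X) : Prop :=
  ∃ u, MemC (secondMoment ξ P) T u ∧ ProcHasChaosExpansion ξ P (Icc 0 T) U u

/-- `U ∈ C¹([0,T], X) ⊗ (L)²`. -/
def ProcMemC1 (ξ : ℕ → Ω → ℝ) (P : Measure Ω) (T : ℝ) (U : ℝ → Ω → X) : Prop :=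
  ∃ u, MemC1 (secondMoment ξ P) T u ∧ ProcHasChaosExpansion ξ P (Icc 0 T) U u

/-- `U ∈ C¹((0,T], X) ⊗ (L)²`. -/
def ProcMemC1Ioc (ξ : ℕ → Ω → ℝ) (P : Measure Ω) (T : ℝ) (U : ℝ → Ω → X) : Prop :=
  ∃ u, MemC1Ioc (secondMoment ξ P) T u ∧ ProcHasChaosExpansion ξ P (Ioc 0 T) U u

/-- The random variable `V` is the (coordinatewise) time derivative of the process `U` at `t`. -/
def IsProcDerivAt (ξ : ℕ → Ω → ℝ) (P : Measure Ω) (T : ℝ) (U : ℝ → Ω → X) (t : ℝ) (V : Ω → X) :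
    Prop :=
  ∃ u, ProcHasChaosExpansion ξ P (Icc 0 T) U u ∧
    (∀ α, DifferentiableWithinAt ℝ (u α) (Icc 0 T) t) ∧
    HasChaosExpansion ξ P V (fun α => timeDeriv T (u α) t)

/-- `𝓛 F = H` for the coordinatewise operator `𝓛 (∑ f_α L_α) = ∑ 𝓛(f_α) L_α`. -/
def IsCoordinatewiseImage (ξ : ℕ → Ω → ℝ) (P : Measure Ω) (𝓛 : X →ₗ.[ℝ] X) (F H : Ω → X) : Prop :=
  ∃ f h : MultiIndex → X, HasChaosExpansion ξ P F f ∧ (∀ α, (f α, h α) ∈ 𝓛.graph) ∧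
    HasChaosExpansion ξ P H h

/-- `U_t(t, ω) = 𝓛 U(t, ω) + G(t, ω)` for almost all `ω`. -/
def ProcSatisfiesAt (ξ : ℕ → Ω → ℝ) (P : Measure Ω) (𝓛 : X →ₗ.[ℝ] X) (T : ℝ)
    (G U : ℝ → Ω → X) (t : ℝ) : Prop :=
  ∃ V H : Ω → X, IsProcDerivAt ξ P T U t V ∧ IsCoordinatewiseImage ξ P 𝓛 (U t) H ∧
    ∀ᵐ ω ∂P, V ω = H ω + G t ω

/-- Classical solutions of the stochastic Cauchy problem `U_t = 𝓛 U + G`, `U(0) = U⁰`, as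
`X`-valued processes. -/
structure IsProcClassicalSolution (ξ : ℕ → Ω → ℝ) (P : Measure Ω) (𝓛 : X →ₗ.[ℝ] X) (T : ℝ)
    (U₀ : Ω → X) (G U : ℝ → Ω → X) : Prop where
  memC : ProcMemC ξ P T U
  memC1 : ProcMemC1Ioc ξ P T U
  initial : ∀ᵐ ω ∂P, U 0 ω = U₀ ω
  equation : ∀ t ∈ Ioc 0 T, ProcSatisfiesAt ξ P 𝓛 T G U t

end ChaosCauchy

end

/-!
The problem decouples: both `d/dt` and `𝓛` act on coefficients, so `u = ∑ u_α L_α` solves it exactly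
when each `u_α` solves the abstract Cauchy problem `u_α' = 𝓛 u_α + g_α`, `u_α(0) = u⁰_α`, in `X`.

For one coefficient, the variation-of-constants formula is a solution of class `C¹` on `[0, T]`. On
the domain of the generator the orbit `t ↦ S_t x` has the continuous right derivative `S_t 𝓛 x`,
hence is continuously differentiable (`hasDerivWithinAt_semigroupExt`). The convolution
`∫₀ᵗ S_{t-s} g(s) ds = ∫₀ᵗ S_r g(t - r) dr` has derivative `S_t g(0) + ∫₀ᵗ S_{t-s} g'(s) ds`
(`hasDerivAt_duhamel`), and comparing its increment over `[t, t + h]` with the action of `S_h` shows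
that it lies in the domain of the generator and solves the equation (`hasGeneratorValue_duhamel`).
The type `(M, w)` of the semigroup bounds `u_α` and `u_α'` on `[0, T]` by `‖u⁰_α‖`, `‖𝓛 u⁰_α‖`,
`sup ‖g_α‖` and `sup ‖g_α'‖` with one constant for all `α`, so that summability of the `C¹`-norms is
inherited from the data (`memC1_and_satisfiesAt_variationOfConstants`). Uniqueness holds since
`s ↦ S_{t-s} z(s)` is constant for the difference `z` of two solutions (`eqOn_of_isSolution`).

For processes in a Hilbert space, Legendre's differential equation makes the Legendre polynomials
orthogonal on `[-1, 1]`, and by independence the `L_α` are orthogonal in `L²(Ω)` with `𝔼 L_α² > 0`.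
Therefore `x ↦ L_α x` are, up to normalization, isometries of `X` onto orthogonal subspaces of
`L²(Ω; X)`. Square summable coefficients thus have a sum (`MemX.exists_hasChaosExpansion`), and the
coefficients of a sum are unique (`HasChaosExpansion.coeff_unique`); this transfers existence and
uniqueness from the coefficients to the processes (`exists_isProcClassicalSolution`).
-/

noncomputable section

namespace ChaosCauchy

section Semigroup

variable {X : Type*} [NormedAddCommGroup X] [NormedSpace ℝ X] {S : ℝ → X →L[ℝ] X} {M w : ℝ}

/-! ### Strongly continuous semigroups -/

/-- The semigroup extended by the identity to negative times. This makes the orbits and the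
convolution integrals below continuous functions of a time that ranges over all of `ℝ`. -/
def semigroupExt (S : ℝ → X →L[ℝ] X) (t : ℝ) : X →L[ℝ] X := S (max t 0)

/-- `x` lies in the domain of the generator of `S`, whose value at `x` is `y`. -/
def HasGeneratorValue (S : ℝ → X →L[ℝ] X) (x y : X) : Prop :=
  Tendsto (fun h : ℝ => h⁻¹ • (S h x - x)) (𝓝[>] 0) (𝓝 y)

lemma semigroupExt_of_nonneg {t : ℝ} (ht : 0 ≤ t) : semigroupExt S t = S t := by
  rw [semigroupExt, max_eq_left ht]

lemma semigroupExt_zero_apply (hS : IsC0Semigroup S) (x : X) : semigroupExt S 0 x = x := by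
  simp [semigroupExt, hS.zero]

lemma norm_semigroupExt_le (hM : IsOfType S M w) {b t : ℝ} (htb : t ≤ b) (hb : 0 ≤ b) :
    ‖semigroupExt S t‖ ≤ M * Real.exp (|w| * b) := by
  refine (hM.2 _ (le_max_right t 0)).trans ?_
  have h1 : max t 0 ≤ b := max_le htb hb
  have h2 : w * max t 0 ≤ |w| * b :=
    (mul_le_mul_of_nonneg_right (le_abs_self w) (le_max_right t 0)).trans
      (mul_le_mul_of_nonneg_left h1 (abs_nonneg w))
  have := hM.1
  gcongr

lemma tendsto_apply_abs (hS : IsC0Semigroup S) (x : X) :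
    Tendsto (fun r : ℝ => S |r| x) (𝓝 0) (𝓝 x) := by
  rw [← nhdsNE_sup_pure (0 : ℝ)]
  refine Tendsto.sup ?_ ?_
  · refine (hS.tendsto x).comp ?_
    exact tendsto_abs_nhdsNE_zero
  · rw [tendsto_pure_left]
    intro s hs
    simpa [hS.zero] using mem_of_mem_nhds hs

lemma norm_sub_le_of_le (hS : IsC0Semigroup S) (hM : IsOfType S M w) {b s t : ℝ} (hs : 0 ≤ s)
    (hst : s ≤ t) (htb : t ≤ b) (x : X) :
    ‖S t x - S s x‖ ≤ M * Real.exp (|w| * b) * ‖S (t - s) x - x‖ := by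
  have h1 : S t x = S s (S (t - s) x) := by
    rw [← ContinuousLinearMap.comp_apply, ← hS.add s (t - s) hs (by linarith)]
    congr 2; ring
  rw [h1, ← map_sub]
  refine ((S s).le_opNorm _).trans ?_
  have := norm_semigroupExt_le hM (hst.trans htb) (hs.trans (hst.trans htb))
  rw [semigroupExt_of_nonneg hs] at this
  gcongr

lemma continuous_semigroupExt_apply (hS : IsC0Semigroup S) (hM : IsOfType S M w) (x : X) :
    Continuous fun t => semigroupExt S t x := by
  rw [continuous_iff_continuousAt]
  intro t₀
  set b := max t₀ 0 + 1
  have hlim : Tendsto (fun t => M * Real.exp (|w| * b) * ‖S |max t 0 - max t₀ 0| x - x‖)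
      (𝓝 t₀) (𝓝 0) := by
    have h0 : Tendsto (fun t : ℝ => max t 0 - max t₀ 0) (𝓝 t₀) (𝓝 0) := by
      have : Continuous fun t : ℝ => max t 0 - max t₀ 0 := by fun_prop
      simpa using this.tendsto t₀
    have h1 := (((tendsto_apply_abs hS x).comp h0).sub_const x).norm.const_mul
      (M * Real.exp (|w| * b))
    simpa using h1
  have hb : ∀ᶠ t : ℝ in 𝓝 t₀, max t 0 ≤ b := by
    have hc : Continuous fun t : ℝ => max t 0 := by fun_prop
    exact (hc.tendsto t₀).eventually_le_const (lt_add_one _)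
  rw [ContinuousAt, tendsto_iff_norm_sub_tendsto_zero]
  refine squeeze_zero' (Eventually.of_forall fun _ => norm_nonneg _) ?_ hlim
  filter_upwards [hb] with t ht
  rcases le_total (max t₀ 0) (max t 0) with h | h
  · rw [abs_of_nonneg (sub_nonneg.2 h)]
    exact norm_sub_le_of_le hS hM (le_max_right _ _) h ht x
  · rw [abs_sub_comm, abs_of_nonneg (sub_nonneg.2 h), semigroupExt, semigroupExt, norm_sub_rev]
    exact norm_sub_le_of_le hS hM (le_max_right _ _) h (lt_add_one _).le x

/-- A semigroup of type `(M, w)` is jointly continuous, since it is strongly continuous and locally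
bounded. -/
lemma continuous_semigroupExt (hS : IsC0Semigroup S) (hM : IsOfType S M w) :
    Continuous fun p : ℝ × X => semigroupExt S p.1 p.2 := by
  rw [continuous_iff_continuousAt]
  rintro ⟨t₀, x₀⟩
  have h1 : Tendsto (fun p : ℝ × X => semigroupExt S p.1 (p.2 - x₀)) (𝓝 (t₀, x₀)) (𝓝 0) := by
    rw [tendsto_zero_iff_norm_tendsto_zero]
    have h2 : Tendsto (fun p : ℝ × X => M * Real.exp (|w| * (max t₀ 0 + 1)) * ‖p.2 - x₀‖)
        (𝓝 (t₀, x₀)) (𝓝 0) := by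
      have : Continuous fun p : ℝ × X => M * Real.exp (|w| * (max t₀ 0 + 1)) * ‖p.2 - x₀‖ := by
        fun_prop
      simpa using this.tendsto (t₀, x₀)
    refine squeeze_zero' (Eventually.of_forall fun _ => norm_nonneg _) ?_ h2
    have hb : ∀ᶠ p : ℝ × X in 𝓝 (t₀, x₀), p.1 ≤ max t₀ 0 + 1 :=
      (continuous_fst.tendsto (t₀, x₀)).eventually_le_const
        ((le_max_left t₀ 0).trans_lt (lt_add_one _))
    filter_upwards [hb] with p hp
    refine ((semigroupExt S p.1).le_opNorm _).trans ?_
    gcongr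
    exact norm_semigroupExt_le hM hp (by positivity)
  have h3 : Tendsto (fun p : ℝ × X => semigroupExt S p.1 x₀) (𝓝 (t₀, x₀))
      (𝓝 (semigroupExt S t₀ x₀)) :=
    ((continuous_semigroupExt_apply hS hM x₀).comp continuous_fst).tendsto (t₀, x₀)
  simpa [ContinuousAt] using h1.add h3

lemma Continuous.semigroupExt_apply {Y : Type*} [TopologicalSpace Y] (hS : IsC0Semigroup S)
    (hM : IsOfType S M w) {τ : Y → ℝ} {f : Y → X} (hτ : Continuous τ) (hf : Continuous f) :
    Continuous fun y => semigroupExt S (τ y) (f y) :=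
  (continuous_semigroupExt hS hM).comp (hτ.prodMk hf)

lemma hasGeneratorValue_semigroupExt (hS : IsC0Semigroup S) {x y : X}
    (hxy : HasGeneratorValue S x y) {t : ℝ} (ht : 0 ≤ t) :
    HasGeneratorValue S (semigroupExt S t x) (semigroupExt S t y) := by
  refine (((semigroupExt S t).continuous.tendsto y).comp hxy).congr' ?_
  filter_upwards [self_mem_nhdsWithin] with h (hh : 0 < h)
  have : S h (S t x) = S t (S h x) := by
    rw [← ContinuousLinearMap.comp_apply, ← ContinuousLinearMap.comp_apply, ← hS.add t h ht hh.le,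
      ← hS.add h t hh.le ht, add_comm]
  simp [semigroupExt_of_nonneg ht, this]

/-- On the domain of the generator the orbit map has the right derivative `S t (𝓛 x)`. -/
lemma hasDerivWithinAt_Ici_semigroupExt (hS : IsC0Semigroup S) {x y : X}
    (hxy : HasGeneratorValue S x y) {t : ℝ} (ht : 0 ≤ t) :
    HasDerivWithinAt (fun s => semigroupExt S s x) (semigroupExt S t y) (Ici t) t := by
  rw [← hasDerivWithinAt_Ioi_iff_Ici, hasDerivWithinAt_iff_tendsto_slope' (by simp)]
  have h1 : Tendsto (fun s : ℝ => s - t) (𝓝[>] t) (𝓝[>] 0) := by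
    refine tendsto_nhdsWithin_iff.2 ⟨?_, ?_⟩
    · have : Continuous fun s : ℝ => s - t := by fun_prop
      simpa using (this.tendsto t).mono_left nhdsWithin_le_nhds
    · filter_upwards [self_mem_nhdsWithin] with s hs
      simpa using hs
  refine ((hasGeneratorValue_semigroupExt hS hxy ht).comp h1).congr' ?_
  filter_upwards [self_mem_nhdsWithin] with s (hs : t < s)
  have h2 : S (s - t) (S t x) = S s x := by
    rw [← ContinuousLinearMap.comp_apply, ← hS.add (s - t) t (by linarith) ht]
    congr 2; ring
  simp [slope, semigroupExt_of_nonneg ht, semigroupExt_of_nonneg (ht.trans hs.le), h2]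

/-! ### The convolution of a semigroup with a differentiable function -/

/-- Rescaling to `[0, 1]`. Applied to an integrand that itself depends on `h`, it leaves a parameter
integral over a fixed interval, whose limit as `h → 0` follows from continuity. -/
lemma integral_eq_smul_integral_segment (f : ℝ → X) (t h : ℝ) :
    ∫ s in t..t + h, f s = h • ∫ θ in (0 : ℝ)..1, f (t + h * θ) := by
  rw [intervalIntegral.smul_integral_comp_add_mul]
  simp

/-- The convolution `∫₀ᵗ S (t - s) f(s) ds`. -/
def duhamel (S : ℝ → X →L[ℝ] X) (f : ℝ → X) (t : ℝ) : X :=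
  ∫ s in (0 : ℝ)..t, semigroupExt S (t - s) (f s)

lemma duhamel_eq_integral_sub (f : ℝ → X) (t : ℝ) :
    duhamel S f t = ∫ r in (0 : ℝ)..t, semigroupExt S r (f (t - r)) := by
  have := intervalIntegral.integral_comp_sub_left (a := 0) (b := t)
    (fun r => semigroupExt S r (f (t - r))) t
  simpa [duhamel] using this

lemma continuous_duhamel (hS : IsC0Semigroup S) (hM : IsOfType S M w) {f : ℝ → X}
    (hf : Continuous f) : Continuous (duhamel S f) := by
  refine intervalIntegral.continuous_parametric_intervalIntegral_of_continuous
    (f := fun t s => semigroupExt S (t - s) (f s)) ?_ continuous_id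
  exact Continuous.semigroupExt_apply hS hM (by fun_prop) (by fun_prop)

lemma norm_duhamel_le (hM : IsOfType S M w) {f : ℝ → X} {b t A : ℝ} (ht : 0 ≤ t) (htb : t ≤ b)
    (hf : ∀ s ∈ Icc 0 b, ‖f s‖ ≤ A) : ‖duhamel S f t‖ ≤ M * Real.exp (|w| * b) * A * b := by
  have hb := ht.trans htb
  have hA : 0 ≤ A := (norm_nonneg _).trans (hf 0 ⟨le_rfl, hb⟩)
  have hM0 := hM.1
  refine (intervalIntegral.norm_integral_le_of_norm_le_const
    (C := M * Real.exp (|w| * b) * A) fun s hs => ?_).trans ?_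
  · rw [uIoc_of_le ht] at hs
    refine ((semigroupExt S (t - s)).le_opNorm _).trans ?_
    gcongr
    · exact norm_semigroupExt_le hM (by linarith [hs.1]) hb
    · exact hf s ⟨hs.1.le, hs.2.trans htb⟩
  · rw [sub_zero, abs_of_nonneg ht]
    gcongr

/-- The mean of `s ↦ S (t + h - s) f(s)` over `[t, t + h]` tends to `f(t)`. -/
lemma tendsto_average_duhamel [CompleteSpace X] (hS : IsC0Semigroup S) (hM : IsOfType S M w)
    {f : ℝ → X} (hf : Continuous f) (t : ℝ) :
    Tendsto (fun h : ℝ => h⁻¹ • ∫ s in t..t + h, semigroupExt S (t + h - s) (f s))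
      (𝓝[≠] 0) (𝓝 (f t)) := by
  have hc : Continuous fun h : ℝ =>
      ∫ θ in (0 : ℝ)..1, semigroupExt S (t + h - (t + h * θ)) (f (t + h * θ)) := by
    refine intervalIntegral.continuous_parametric_intervalIntegral_of_continuous'
      (f := fun h θ => semigroupExt S (t + h - (t + h * θ)) (f (t + h * θ))) ?_ 0 1
    exact Continuous.semigroupExt_apply hS hM (by fun_prop) (by fun_prop)
  have h1 := hc.tendsto 0
  simp only [zero_mul, add_zero, sub_self, semigroupExt_zero_apply hS,
    intervalIntegral.integral_const, sub_zero, one_smul] at h1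
  refine (h1.mono_left nhdsWithin_le_nhds).congr' ?_
  filter_upwards [self_mem_nhdsWithin] with h hh
  rw [integral_eq_smul_integral_segment, inv_smul_smul₀ hh]

/-- The derivative of the convolution: it falls on `f`, once the convolution is written as
`∫₀ᵗ S r f(t - r) dr`. -/
lemma hasDerivAt_duhamel [CompleteSpace X] (hS : IsC0Semigroup S) (hM : IsOfType S M w)
    {f f' : ℝ → X} (hf' : Continuous f') (hff' : ∀ t, HasDerivAt f (f' t) t) (t : ℝ) :
    HasDerivAt (duhamel S f) (semigroupExt S t (f 0) + duhamel S f' t) t := by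
  have hf : Continuous f := continuous_iff_continuousAt.2 fun t => (hff' t).continuousAt
  rw [hasDerivAt_iff_tendsto_slope_zero]
  -- The increment is split at the upper limit `t` of integration.
  have hA : Continuous fun h : ℝ =>
      ∫ θ in (0 : ℝ)..1, semigroupExt S (t + h * θ) (f (t + h - (t + h * θ))) := by
    refine intervalIntegral.continuous_parametric_intervalIntegral_of_continuous'
      (f := fun h θ => semigroupExt S (t + h * θ) (f (t + h - (t + h * θ)))) ?_ 0 1
    exact Continuous.semigroupExt_apply hS hM (by fun_prop) (by fun_prop)
  have hD : Continuous fun p : ℝ × ℝ => ∫ θ in (0 : ℝ)..1, f' (p.2 + p.1 * θ) := by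
    refine intervalIntegral.continuous_parametric_intervalIntegral_of_continuous'
      (f := fun (p : ℝ × ℝ) θ => f' (p.2 + p.1 * θ)) ?_ 0 1
    fun_prop
  have hB : Continuous fun h : ℝ => ∫ r in (0 : ℝ)..t,
      semigroupExt S r (∫ θ in (0 : ℝ)..1, f' (t - r + h * θ)) := by
    refine intervalIntegral.continuous_parametric_intervalIntegral_of_continuous'
      (f := fun h r => semigroupExt S r (∫ θ in (0 : ℝ)..1, f' (t - r + h * θ))) ?_ 0 t
    refine Continuous.semigroupExt_apply hS hM (by fun_prop) ?_
    exact hD.comp (f := fun q : ℝ × ℝ => (q.1, t - q.2)) (by fun_prop)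
  have hlim := (hA.tendsto 0).add (hB.tendsto 0)
  simp only [zero_mul, add_zero, sub_self, intervalIntegral.integral_const, sub_zero, one_smul]
    at hlim
  rw [duhamel_eq_integral_sub f']
  refine (hlim.mono_left nhdsWithin_le_nhds).congr' ?_
  filter_upwards [self_mem_nhdsWithin] with h hh
  have hint : ∀ a b c, IntervalIntegrable (fun r => semigroupExt S r (f (c - r))) volume a b :=
    fun a b c => (Continuous.semigroupExt_apply hS hM continuous_id
      (by fun_prop : Continuous fun r => f (c - r))).intervalIntegrable _ _
  have hincr : ∀ b, f (b + h) - f b = h • ∫ θ in (0 : ℝ)..1, f' (b + h * θ) := fun b => by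
    rw [← integral_eq_smul_integral_segment, intervalIntegral.integral_eq_sub_of_hasDerivAt
      (fun s _ => hff' s) (hf'.intervalIntegrable _ _)]
  have hsecond : (∫ r in (0 : ℝ)..t, semigroupExt S r (f (t + h - r))) -
      (∫ r in (0 : ℝ)..t, semigroupExt S r (f (t - r))) =
      h • ∫ r in (0 : ℝ)..t, semigroupExt S r (∫ θ in (0 : ℝ)..1, f' (t - r + h * θ)) := by
    rw [← intervalIntegral.integral_sub (hint _ _ _) (hint _ _ _),
      ← intervalIntegral.integral_smul]
    refine intervalIntegral.integral_congr fun r _ => ?_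
    rw [← map_sub, ← map_smul, ← hincr]
    congr 3
    ring
  rw [duhamel_eq_integral_sub, duhamel_eq_integral_sub,
    ← intervalIntegral.integral_add_adjacent_intervals (hint 0 t (t + h)) (hint t (t + h) (t + h)),
    integral_eq_smul_integral_segment _ t h, add_comm (∫ r in (0 : ℝ)..t, _), add_sub_assoc,
    hsecond, ← smul_add, inv_smul_smul₀ hh]

/-- The convolution takes values in the domain of the generator: for `h > 0`,
`S h` maps the convolution at time `t` to the one at time `t + h` minus an integral over
`[t, t + h]`. -/
lemma hasGeneratorValue_duhamel [CompleteSpace X] (hS : IsC0Semigroup S) (hM : IsOfType S M w)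
    {f f' : ℝ → X} (hf' : Continuous f') (hff' : ∀ t, HasDerivAt f (f' t) t) {t : ℝ}
    (ht : 0 ≤ t) :
    HasGeneratorValue S (duhamel S f t)
      (semigroupExt S t (f 0) + duhamel S f' t - f t) := by
  have hf : Continuous f := continuous_iff_continuousAt.2 fun t => (hff' t).continuousAt
  have h1 := (hasDerivAt_iff_tendsto_slope_zero.1 (hasDerivAt_duhamel hS hM hf' hff' t)).sub
    (tendsto_average_duhamel hS hM hf t)
  refine (h1.mono_left (nhdsWithin_mono _ fun h (hh : 0 < h) => hh.ne')).congr' ?_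
  filter_upwards [self_mem_nhdsWithin] with h (hh : 0 < h)
  have hint : ∀ a b c, IntervalIntegrable (fun s => semigroupExt S (c - s) (f s)) volume a b :=
    fun a b c => (Continuous.semigroupExt_apply hS hM
      (by fun_prop : Continuous fun s : ℝ => c - s) hf).intervalIntegrable _ _
  have h2 : S h (duhamel S f t) = ∫ s in (0 : ℝ)..t, semigroupExt S (t + h - s) (f s) := by
    rw [duhamel, ← ContinuousLinearMap.intervalIntegral_comp_comm _ (hint 0 t t)]
    refine intervalIntegral.integral_congr fun s hs => ?_
    rw [uIcc_of_le ht] at hs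
    rw [semigroupExt_of_nonneg (by linarith [hs.2]), semigroupExt_of_nonneg (by linarith [hs.2]),
      ← ContinuousLinearMap.comp_apply, ← hS.add h (t - s) hh.le (by linarith [hs.2])]
    congr 2; ring
  have h3 : duhamel S f (t + h) = S h (duhamel S f t) +
      ∫ s in t..t + h, semigroupExt S (t + h - s) (f s) := by
    rw [h2, duhamel, intervalIntegral.integral_add_adjacent_intervals (hint _ _ _) (hint _ _ _)]
  rw [h3, ← smul_sub]
  congr 1
  abel

/-- A continuous function with a continuous right derivative is continuously differentiable. -/
lemma hasDerivWithinAt_Ici_zero_of_right {u d : ℝ → X} [CompleteSpace X] (hu : Continuous u)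
    (hd : Continuous d) (h : ∀ t, 0 ≤ t → HasDerivWithinAt u (d t) (Ici t) t) {t : ℝ}
    (ht : 0 ≤ t) : HasDerivWithinAt u (d t) (Ici 0) t := by
  have h1 : ∀ s ∈ Ici (0 : ℝ), u s = u 0 + ∫ r in (0 : ℝ)..s, d r := fun s hs => by
    rw [intervalIntegral.integral_eq_sub_of_hasDeriv_right hu.continuousOn
      (fun r hr => (h r (by simpa [min_eq_left hs.out] using hr.1.le)).mono Ioi_subset_Ici_self)
      (hd.intervalIntegrable _ _)]
    abel
  have h2 : HasDerivAt (fun s => u 0 + ∫ r in (0 : ℝ)..s, d r) (d t) t :=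
    (intervalIntegral.integral_hasDerivAt_right (hd.intervalIntegrable _ _)
      (hd.stronglyMeasurableAtFilter _ _) hd.continuousAt).const_add _
  exact h2.hasDerivWithinAt.congr h1 (h1 t ht)

lemma hasDerivWithinAt_semigroupExt [CompleteSpace X] (hS : IsC0Semigroup S)
    (hM : IsOfType S M w) {x y : X} (hxy : HasGeneratorValue S x y) {t : ℝ} (ht : 0 ≤ t) :
    HasDerivWithinAt (fun s => semigroupExt S s x) (semigroupExt S t y) (Ici 0) t :=
  hasDerivWithinAt_Ici_zero_of_right (continuous_semigroupExt_apply hS hM x)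
    (continuous_semigroupExt_apply hS hM y)
    (fun _ hs => hasDerivWithinAt_Ici_semigroupExt hS hxy hs) ht

/-! ### Uniqueness for the abstract Cauchy problem -/

/-- The product rule for `A s (z s)`, where `A` is only strongly differentiable. -/
lemma hasDerivAt_apply {A : ℝ → X →L[ℝ] X} {z : ℝ → X} {s₀ C : ℝ} {z' y : X}
    (hz : HasDerivAt z z' s₀) (hA : HasDerivAt (fun s => A s (z s₀)) y s₀)
    (hC : ∀ᶠ s in 𝓝 s₀, ‖A s‖ ≤ C) (hc : ContinuousAt (fun s => A s z') s₀) :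
    HasDerivAt (fun s => A s (z s)) (y + A s₀ z') s₀ := by
  rw [hasDerivAt_iff_tendsto_slope] at hz hA ⊢
  have h1 : Tendsto (fun s => A s (slope z s₀ s - z')) (𝓝[≠] s₀) (𝓝 0) := by
    rw [tendsto_zero_iff_norm_tendsto_zero]
    have h2 : Tendsto (fun s => C * ‖slope z s₀ s - z'‖) (𝓝[≠] s₀) (𝓝 0) := by
      simpa using (hz.sub_const z').norm.const_mul C
    refine squeeze_zero' (Eventually.of_forall fun _ => norm_nonneg _) ?_ h2
    filter_upwards [nhdsWithin_le_nhds hC] with s hs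
    exact ((A s).le_opNorm _).trans (by gcongr)
  have h3 := hA.add (h1.add (hc.tendsto.mono_left nhdsWithin_le_nhds))
  rw [zero_add] at h3
  refine h3.congr fun s => ?_
  simp only [slope, vsub_eq_sub, map_sub, map_smul, smul_sub]
  abel

/-- The homogeneous Cauchy problem with initial value `0` has only the zero solution: for a
solution `z`, the function `s ↦ S (t - s) z(s)` has derivative zero on `(0, t)`. -/
lemma eq_zero_of_homogeneous [CompleteSpace X] (hS : IsC0Semigroup S) (hM : IsOfType S M w)
    {z z' : ℝ → X} {t : ℝ} (ht : 0 < t) (hz : ContinuousOn z (Icc 0 t)) (hz0 : z 0 = 0)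
    (hzz' : ∀ s ∈ Ioo 0 t, HasDerivAt z (z' s) s)
    (hgen : ∀ s ∈ Ioo 0 t, HasGeneratorValue S (z s) (z' s)) : z t = 0 := by
  have hd : ∀ s ∈ Ioo 0 t, HasDerivAt (fun s => semigroupExt S (t - s) (z s)) 0 s := by
    intro s hs
    have h1 : HasDerivAt (fun r => semigroupExt S r (z s)) (semigroupExt S (t - s) (z' s))
        (t - s) :=
      (hasDerivWithinAt_semigroupExt hS hM (hgen s hs) (by linarith [hs.2])).hasDerivAt
        (Ici_mem_nhds (by linarith [hs.2]))
    have h2 : HasDerivAt (fun r => semigroupExt S (t - r) (z s))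
        (-semigroupExt S (t - s) (z' s)) s := by
      simpa using h1.comp_const_sub t s
    have h3 := hasDerivAt_apply (A := fun s => semigroupExt S (t - s)) (C := M * Real.exp (|w| * t))
      (hzz' s hs) h2
      (by
        filter_upwards [lt_mem_nhds hs.1] with r hr
        exact norm_semigroupExt_le hM (by linarith) ht.le)
      (Continuous.semigroupExt_apply hS hM (by fun_prop) continuous_const).continuousAt
    simpa using h3
  have hc : ContinuousOn (fun s => semigroupExt S (t - s) (z s)) (Icc 0 t) :=
    (continuous_semigroupExt hS hM).comp_continuousOn
      (ContinuousOn.prodMk (by fun_prop) hz)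
  have h0 := intervalIntegral.integral_eq_sub_of_hasDerivAt_of_le ht.le hc hd
    (by simp)
  simp only [intervalIntegral.integral_zero, sub_self, semigroupExt_zero_apply hS, hz0, map_zero,
    sub_zero] at h0
  exact h0.symm

end Semigroup

section Coefficients

variable {X : Type*} [NormedAddCommGroup X] [NormedSpace ℝ X] {S : ℝ → X →L[ℝ] X} {M w T : ℝ}

/-! ### The variation-of-constants formula for one coefficient -/

lemma exists_contDiff_extension [CompleteSpace X] (hT : 0 < T) {g : ℝ → X}
    (hg : ContDiffOn ℝ 1 g (Icc 0 T)) :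
    ∃ f f' : ℝ → X, Continuous f' ∧ (∀ t, HasDerivAt f (f' t) t) ∧ EqOn f g (Icc 0 T) ∧
      EqOn f' (timeDeriv T g) (Icc 0 T) := by
  have hu := uniqueDiffOn_Icc hT
  have hc : ContinuousOn (timeDeriv T g) (Icc 0 T) := hg.continuousOn_derivWithin hu le_rfl
  set f' : ℝ → X := IccExtend hT.le ((Icc 0 T).domRestrict (timeDeriv T g)) with hf'
  have hf'c : Continuous f' := (continuousOn_iff_continuous_domRestrict.1 hc).Icc_extend'
  have hf'e : EqOn f' (timeDeriv T g) (Icc 0 T) := fun t ht => by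
    rw [hf', IccExtend_of_mem hT.le _ ht, domRestrict_apply]
  refine ⟨fun t => g 0 + ∫ s in (0 : ℝ)..t, f' s, f', hf'c, fun t => ?_, fun t ht => ?_, hf'e⟩
  · exact (intervalIntegral.integral_hasDerivAt_right (hf'c.intervalIntegrable _ _)
      (hf'c.stronglyMeasurableAtFilter _ _) hf'c.continuousAt).const_add _
  · have := intervalIntegral.integral_eq_sub_of_hasDerivAt_of_le (f := g) (f' := f') ht.1
      (hg.continuousOn.mono (Icc_subset_Icc_right ht.2)) (fun s hs => by
        have hs' : s ∈ Icc 0 T := ⟨hs.1.le, hs.2.le.trans ht.2⟩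
        rw [hf'e hs']
        exact ((hg.differentiableOn one_ne_zero s hs').hasDerivWithinAt).hasDerivAt
          (Icc_mem_nhds hs.1 (hs.2.trans_le ht.2))) (hf'c.intervalIntegrable _ _)
    simp only [this]
    abel

/-- If `x` is in the domain of the generator and `g` is continuously differentiable, then
`u(t) = S t x + ∫₀ᵗ S (t - s) g(s) ds` is a continuously differentiable solution of
`u' = 𝓛 u + g` on `[0, T]`, and `u`, `u'` are bounded by the data. -/
lemma exists_deriv_mildSolution [CompleteSpace X] (hT : 0 < T) (hS : IsC0Semigroup S)
    (hM : IsOfType S M w) {x y : X} (hxy : HasGeneratorValue S x y) {g : ℝ → X}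
    (hg : ContDiffOn ℝ 1 g (Icc 0 T)) {A A' : ℝ} (hA : ∀ t ∈ Icc 0 T, ‖g t‖ ≤ A)
    (hA' : ∀ t ∈ Icc 0 T, ‖timeDeriv T g t‖ ≤ A') :
    ∃ d : ℝ → X, Continuous d ∧ ∀ t ∈ Icc 0 T,
      HasDerivWithinAt (fun t => S t x + ∫ s in (0 : ℝ)..t, S (t - s) (g s)) (d t) (Icc 0 T) t ∧
      HasGeneratorValue S (S t x + ∫ s in (0 : ℝ)..t, S (t - s) (g s)) (d t - g t) ∧
      ‖S t x + ∫ s in (0 : ℝ)..t, S (t - s) (g s)‖ ≤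
        M * Real.exp (|w| * T) * (1 + T) * (‖x‖ + A) ∧
      ‖d t‖ ≤ M * Real.exp (|w| * T) * (1 + T) * (‖y‖ + A + A') := by
  obtain ⟨f, f', hf'c, hff', hfg, hf'g⟩ := exists_contDiff_extension hT hg
  have hu : ∀ t ∈ Icc 0 T, S t x + ∫ s in (0 : ℝ)..t, S (t - s) (g s) =
      semigroupExt S t x + duhamel S f t := fun t ht => by
    rw [semigroupExt_of_nonneg ht.1, duhamel]
    congr 1
    refine intervalIntegral.integral_congr fun s hs => ?_
    rw [uIcc_of_le ht.1] at hs
    rw [semigroupExt_of_nonneg (by linarith [hs.2]), hfg ⟨hs.1, hs.2.trans ht.2⟩]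
  have h0 : (0 : ℝ) ∈ Icc 0 T := ⟨le_rfl, hT.le⟩
  have hA0 : 0 ≤ A := (norm_nonneg _).trans (hA 0 h0)
  have hA0' : 0 ≤ A' := (norm_nonneg _).trans (hA' 0 h0)
  have hM0 := hM.1
  have hK : 0 < M * Real.exp (|w| * T) := by positivity
  refine ⟨fun t => semigroupExt S t y + (semigroupExt S t (f 0) + duhamel S f' t), ?_,
    fun t ht => ⟨?_, ?_, ?_, ?_⟩⟩
  · exact (continuous_semigroupExt_apply hS hM y).add
      ((continuous_semigroupExt_apply hS hM _).add (continuous_duhamel hS hM hf'c))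
  · refine HasDerivWithinAt.congr ?_ hu (hu t ht)
    exact ((hasDerivWithinAt_semigroupExt hS hM hxy ht.1).mono Icc_subset_Ici_self).add
      (hasDerivAt_duhamel hS hM hf'c hff' t).hasDerivWithinAt
  · rw [hu t ht]
    have := (hasGeneratorValue_semigroupExt hS hxy ht.1).add
      (hasGeneratorValue_duhamel hS hM hf'c hff' ht.1)
    rw [← hfg ht, add_sub_assoc]
    refine this.congr fun h => ?_
    rw [map_add, ← smul_add]
    congr 1
    abel
  · rw [hu t ht]
    have h1 := (semigroupExt S t).le_of_opNorm_le (norm_semigroupExt_le hM ht.2 hT.le) x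
    have h2 := norm_duhamel_le hM ht.1 ht.2 (f := f) (A := A) (fun s hs => by
      rw [hfg hs]; exact hA s hs)
    calc _ ≤ M * Real.exp (|w| * T) * (‖x‖ + A * T) := by
          refine (norm_add_le _ _).trans ?_
          linarith
      _ ≤ M * Real.exp (|w| * T) * (1 + T) * (‖x‖ + A) := by
          rw [mul_assoc _ (1 + T)]
          gcongr
          nlinarith [mul_nonneg hT.le (norm_nonneg x)]
  · have h1 := (semigroupExt S t).le_of_opNorm_le (norm_semigroupExt_le hM ht.2 hT.le) y
    have h2 := (semigroupExt S t).le_of_opNorm_le (norm_semigroupExt_le hM ht.2 hT.le) (f 0)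
    have h3 := norm_duhamel_le hM ht.1 ht.2 (f := f') (A := A') (fun s hs => by
      rw [hf'g hs]; exact hA' s hs)
    have h4 : ‖f 0‖ ≤ A := by rw [hfg h0]; exact hA 0 h0
    calc _ ≤ M * Real.exp (|w| * T) * (‖y‖ + ‖f 0‖ + A' * T) := by
          refine (norm_add_le _ _).trans ?_
          have := norm_add_le (semigroupExt S t (f 0)) (duhamel S f' t)
          linarith
      _ ≤ M * Real.exp (|w| * T) * (1 + T) * (‖y‖ + A + A') := by
          rw [mul_assoc _ (1 + T)]
          gcongr
          nlinarith [mul_nonneg hT.le (norm_nonneg y), mul_nonneg hT.le hA0]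

lemma IsGenerator.hasGeneratorValue {𝓛 : X →ₗ.[ℝ] X} (h : IsGenerator 𝓛 S) {x y : X} :
    (x, y) ∈ 𝓛.graph ↔ HasGeneratorValue S x y := h x y

/-- Two solutions of the inhomogeneous Cauchy problem coincide. -/
lemma eqOn_of_isSolution [CompleteSpace X] (hS : IsC0Semigroup S) (hM : IsOfType S M w)
    {𝓛 : X →ₗ.[ℝ] X} (h_gen : IsGenerator 𝓛 S) {g u v : ℝ → X}
    (hu : ContinuousOn u (Icc 0 T)) (hv : ContinuousOn v (Icc 0 T)) (huv : u 0 = v 0)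
    (hu' : ∀ t ∈ Ioc 0 T, DifferentiableWithinAt ℝ u (Icc 0 T) t)
    (hv' : ∀ t ∈ Ioc 0 T, DifferentiableWithinAt ℝ v (Icc 0 T) t)
    (hgu : ∀ t ∈ Ioc 0 T, (u t, timeDeriv T u t - g t) ∈ 𝓛.graph)
    (hgv : ∀ t ∈ Ioc 0 T, (v t, timeDeriv T v t - g t) ∈ 𝓛.graph) :
    EqOn u v (Icc 0 T) := by
  intro t ht
  rcases ht.1.eq_or_lt with rfl | ht0
  · exact huv
  rw [← sub_eq_zero]
  refine eq_zero_of_homogeneous hS hM (z := fun s => u s - v s)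
    (z' := fun s => timeDeriv T u s - timeDeriv T v s) ht0
    ((hu.sub hv).mono (Icc_subset_Icc_right ht.2)) (sub_eq_zero.2 huv) (fun s hs => ?_)
    fun s hs => ?_
  · have hs' : s ∈ Ioc 0 T := ⟨hs.1, hs.2.le.trans ht.2⟩
    have hn : Icc 0 T ∈ 𝓝 s := Icc_mem_nhds hs.1 (hs.2.trans_le ht.2)
    exact ((hu' s hs').hasDerivWithinAt.hasDerivAt hn).sub
      ((hv' s hs').hasDerivWithinAt.hasDerivAt hn)
  · have hs' : s ∈ Ioc 0 T := ⟨hs.1, hs.2.le.trans ht.2⟩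
    have := 𝓛.graph.sub_mem (hgu s hs') (hgv s hs')
    simp only [Prod.mk_sub_mk, sub_sub_sub_cancel_right] at this
    exact h_gen.hasGeneratorValue.1 this

/-! ### Weighted spaces of coefficients -/

section supNorm

variable {Y : Type*} [NormedAddCommGroup Y]

lemma supNorm_nonneg (K : Set ℝ) (f : ℝ → Y) : 0 ≤ supNorm K f :=
  Real.iSup_nonneg fun _ => norm_nonneg _

lemma norm_le_supNorm {K : Set ℝ} (hK : IsCompact K) {f : ℝ → Y} (hf : ContinuousOn f K) {t : ℝ}
    (ht : t ∈ K) : ‖f t‖ ≤ supNorm K f := by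
  have hb : BddAbove (range fun t : K => ‖f t‖) := by
    have := hK.bddAbove_image hf.norm
    rwa [image_eq_range] at this
  exact le_ciSup hb ⟨t, ht⟩

lemma supNorm_le {K : Set ℝ} (hK : K.Nonempty) {f : ℝ → Y} {A : ℝ} (h : ∀ t ∈ K, ‖f t‖ ≤ A) :
    supNorm K f ≤ A := by
  have := hK.to_subtype
  exact ciSup_le fun t => h t t.2

lemma MemC.memX {ϖ : MultiIndex → ℝ} (hϖ : ∀ α, 0 ≤ ϖ α) {v : MultiIndex → ℝ → Y}
    (hv : MemC ϖ T v) {t : ℝ} (ht : t ∈ Icc 0 T) :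
    MemX ϖ fun α => v α t := by
  refine Summable.of_nonneg_of_le (fun α => mul_nonneg (sq_nonneg _) (hϖ α)) (fun α => ?_) hv.2
  have := hϖ α
  have := norm_le_supNorm isCompact_Icc (hv.1 α) ht
  gcongr

end supNorm

variable {ϖ : MultiIndex → ℝ} {u : MultiIndex → ℝ → X}

lemma MemC1.continuousOn_timeDeriv (hT : 0 < T) (hu : MemC1 ϖ T u) (α : MultiIndex) :
    ContinuousOn (timeDeriv T (u α)) (Icc 0 T) :=
  (hu.1 α).continuousOn_derivWithin (uniqueDiffOn_Icc hT) le_rfl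

lemma MemC1.memC (hϖ : ∀ α, 0 ≤ ϖ α) (hu : MemC1 ϖ T u) : MemC ϖ T u := by
  refine ⟨fun α => (hu.1 α).continuousOn, Summable.of_nonneg_of_le
    (fun α => mul_nonneg (sq_nonneg _) (hϖ α)) (fun α => ?_) hu.2⟩
  have := hϖ α
  gcongr
  exact le_add_of_nonneg_right (sq_nonneg _)

lemma MemC1.memC1Ioc (hϖ : ∀ α, 0 ≤ ϖ α) (hT : 0 < T) (hu : MemC1 ϖ T u) : MemC1Ioc ϖ T u := by
  refine ⟨fun α => (hu.1 α).mono Ioc_subset_Icc_self, fun ε hε => Summable.of_nonneg_of_le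
    (fun α => mul_nonneg (by positivity) (hϖ α)) (fun α => ?_) hu.2⟩
  have hsub : Icc ε T ⊆ Icc 0 T := Icc_subset_Icc_left hε.1.le
  have hne : (Icc ε T).Nonempty := nonempty_Icc.2 hε.2.le
  have h1 : supNorm (Icc ε T) (u α) ≤ supNorm (Icc 0 T) (u α) :=
    supNorm_le hne fun t ht => norm_le_supNorm isCompact_Icc (hu.1 α).continuousOn (hsub ht)
  have h2 : supNorm (Icc ε T) (timeDeriv T (u α)) ≤ supNorm (Icc 0 T) (timeDeriv T (u α)) :=
    supNorm_le hne fun t ht =>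
      norm_le_supNorm isCompact_Icc (hu.continuousOn_timeDeriv hT α) (hsub ht)
  have := hϖ α
  have := supNorm_nonneg (Icc ε T) (u α)
  have := supNorm_nonneg (Icc ε T) (timeDeriv T (u α))
  gcongr

lemma MemC1.memX_timeDeriv (hϖ : ∀ α, 0 ≤ ϖ α) (hT : 0 < T) (hu : MemC1 ϖ T u) {t : ℝ}
    (ht : t ∈ Icc 0 T) : MemX ϖ fun α => timeDeriv T (u α) t := by
  refine Summable.of_nonneg_of_le (fun α => mul_nonneg (sq_nonneg _) (hϖ α)) (fun α => ?_) hu.2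
  have := hϖ α
  have := norm_le_supNorm isCompact_Icc (hu.continuousOn_timeDeriv hT α) ht
  gcongr
  exact le_add_of_nonneg_of_le (sq_nonneg _) (by gcongr)

/-- The variation-of-constants formula gives an element of `C¹([0,T], X) ⊗ (L)²` that satisfies the
equation up to `t = 0`. -/
lemma memC1_and_satisfiesAt_variationOfConstants [CompleteSpace X] (hϖ : ∀ α, 0 ≤ ϖ α)
    (hT : 0 < T) {𝓛 : X →ₗ.[ℝ] X} (hS : IsC0Semigroup S) (h_gen : IsGenerator 𝓛 S)
    (hM : IsOfType S M w) {u₀ y₀ : MultiIndex → X} (hu₀ : MemX ϖ u₀) (hy₀ : MemX ϖ y₀)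
    (hL : ∀ α, (u₀ α, y₀ α) ∈ 𝓛.graph) {g : MultiIndex → ℝ → X} (hg : MemC1 ϖ T g) :
    MemC1 ϖ T (variationOfConstants S u₀ g) ∧
      ∀ t ∈ Icc 0 T, SatisfiesAt 𝓛 T g (variationOfConstants S u₀ g) t := by
  have hud := uniqueDiffOn_Icc hT
  have hne : (Icc 0 T).Nonempty := nonempty_Icc.2 hT.le
  choose d hdc hd using fun α => exists_deriv_mildSolution hT hS hM
    (h_gen.hasGeneratorValue.1 (hL α)) (hg.1 α)
    (fun t ht => norm_le_supNorm isCompact_Icc (hg.1 α).continuousOn ht)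
    (fun t ht => norm_le_supNorm isCompact_Icc (hg.continuousOn_timeDeriv hT α) ht)
  have hder : ∀ α, ∀ t ∈ Icc 0 T, timeDeriv T (variationOfConstants S u₀ g α) t = d α t :=
    fun α t ht => (hd α t ht).1.derivWithin (hud t ht)
  refine ⟨⟨fun α => ?_, ?_⟩, fun t ht α => ?_⟩
  · rw [contDiffOn_one_iff_derivWithin hud]
    exact ⟨fun t ht => (hd α t ht).1.differentiableWithinAt,
      (hdc α).continuousOn.congr (hder α)⟩
  · set K := M * Real.exp (|w| * T) * (1 + T)
    refine Summable.of_nonneg_of_le (fun α => mul_nonneg (by positivity) (hϖ α)) (fun α => ?_)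
      (((hu₀.add hy₀).add hg.2).mul_left (5 * K ^ 2))
    set A := supNorm (Icc 0 T) (g α)
    set A' := supNorm (Icc 0 T) (timeDeriv T (g α))
    have h1 : supNorm (Icc 0 T) (variationOfConstants S u₀ g α) ≤ K * (‖u₀ α‖ + A) :=
      supNorm_le hne fun t ht => (hd α t ht).2.2.1
    have h2 : supNorm (Icc 0 T) (timeDeriv T (variationOfConstants S u₀ g α)) ≤
        K * (‖y₀ α‖ + A + A') :=
      supNorm_le hne fun t ht => by
        rw [hder α t ht]
        exact (hd α t ht).2.2.2
    have := supNorm_nonneg (Icc 0 T) (variationOfConstants S u₀ g α)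
    have := supNorm_nonneg (Icc 0 T) (timeDeriv T (variationOfConstants S u₀ g α))
    have := hϖ α
    calc _ ≤ ((K * (‖u₀ α‖ + A)) ^ 2 + (K * (‖y₀ α‖ + A + A')) ^ 2) * ϖ α := by gcongr
      _ = K ^ 2 * ((‖u₀ α‖ + A) ^ 2 + (‖y₀ α‖ + A + A') ^ 2) * ϖ α := by ring
      _ ≤ K ^ 2 * (5 * (‖u₀ α‖ ^ 2 + ‖y₀ α‖ ^ 2 + (A ^ 2 + A' ^ 2))) * ϖ α := by
          gcongr
          nlinarith [sq_nonneg (‖u₀ α‖ - A), sq_nonneg (‖y₀ α‖ - A), sq_nonneg (‖y₀ α‖ - A'),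
            sq_nonneg (A - A'), sq_nonneg ‖u₀ α‖, sq_nonneg ‖y₀ α‖, sq_nonneg A']
      _ = _ := by ring
  · rw [hder α t ht]
    exact h_gen.hasGeneratorValue.2 (hd α t ht).2.1

end Coefficients

/-! ### Orthogonality of the Legendre polynomials -/

lemma differentiable_legendreP : ∀ n, Differentiable ℝ (legendreP n)
  | 0 => by
    have : legendreP 0 = fun _ => 1 := by ext; rw [legendreP]
    rw [this]; fun_prop
  | 1 => by
    have : legendreP 1 = fun x => x := by ext; rw [legendreP]
    rw [this]; fun_prop
  | n + 2 => by
    have h1 := differentiable_legendreP (n + 1)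
    have h0 := differentiable_legendreP n
    have : legendreP (n + 2) = fun x => ((2 * (n : ℝ) + 3) * x * legendreP (n + 1) x -
        ((n : ℝ) + 1) * legendreP n x) / ((n : ℝ) + 2) := by ext; rw [legendreP]
    rw [this]; fun_prop

lemma continuous_legendreP (n : ℕ) : Continuous (legendreP n) :=
  (differentiable_legendreP n).continuous

lemma legendreP_one_eq_one : ∀ n, legendreP n 1 = 1
  | 0 => by rw [legendreP]
  | 1 => by rw [legendreP]
  | n + 2 => by
    rw [legendreP, legendreP_one_eq_one (n + 1), legendreP_one_eq_one n]
    field_simp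
    ring

lemma deriv_legendreP_add_two (n : ℕ) (x : ℝ) :
    ((n : ℝ) + 2) * deriv (legendreP (n + 2)) x =
      (2 * (n : ℝ) + 3) * (legendreP (n + 1) x + x * deriv (legendreP (n + 1)) x) -
        ((n : ℝ) + 1) * deriv (legendreP n) x := by
  have h1 := (differentiable_legendreP (n + 1) x).hasDerivAt
  have h0 := (differentiable_legendreP n x).hasDerivAt
  have h2 : HasDerivAt (legendreP (n + 2)) (((2 * (n : ℝ) + 3) *
      (legendreP (n + 1) x + x * deriv (legendreP (n + 1)) x) -
        ((n : ℝ) + 1) * deriv (legendreP n) x) / ((n : ℝ) + 2)) x := by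
    have : legendreP (n + 2) = fun x => ((2 * (n : ℝ) + 3) * x * legendreP (n + 1) x -
        ((n : ℝ) + 1) * legendreP n x) / ((n : ℝ) + 2) := by ext; rw [legendreP]
    rw [this]
    have h3 := ((((hasDerivAt_id x).const_mul (2 * (n : ℝ) + 3)).mul h1).sub
      (h0.const_mul ((n : ℝ) + 1))).div_const ((n : ℝ) + 2)
    refine h3.congr_deriv ?_
    simp only [id]
    ring
  rw [h2.deriv]
  field_simp

/-- Two first-order identities, which determine each other through the recursion. -/
lemma deriv_legendreP_identities (n : ℕ) (x : ℝ) :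
    deriv (legendreP (n + 1)) x = x * deriv (legendreP n) x + ((n : ℝ) + 1) * legendreP n x ∧
      x * deriv (legendreP (n + 1)) x - deriv (legendreP n) x =
        ((n : ℝ) + 1) * legendreP (n + 1) x := by
  induction n with
  | zero =>
    have h0 : legendreP 0 = fun _ => 1 := by ext; rw [legendreP]
    have h1 : legendreP 1 = fun x => x := by ext; rw [legendreP]
    simp [h0, h1]
  | succ n ih =>
    obtain ⟨h1, h2⟩ := ih
    have h3 := deriv_legendreP_add_two n x
    have hn : ((n : ℝ) + 2) ≠ 0 := by positivity
    have h4 : ((n : ℝ) + 2) * legendreP (n + 2) x =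
        (2 * (n : ℝ) + 3) * x * legendreP (n + 1) x - ((n : ℝ) + 1) * legendreP n x := by
      rw [legendreP]; field_simp
    have h5 : deriv (legendreP (n + 2)) x =
        x * deriv (legendreP (n + 1)) x + ((n : ℝ) + 2) * legendreP (n + 1) x := by
      refine mul_left_cancel₀ hn ?_
      linear_combination h3 + ((n : ℝ) + 1) * h2
    push_cast
    refine ⟨by rw [h5]; ring, ?_⟩
    rw [h5]
    linear_combination (-1) * h1 + x * h2 - h4

/-- Legendre's differential equation `((1 - x²) p_n')' = -n (n + 1) p_n`. -/
lemma hasDerivAt_legendreP_equation (n : ℕ) (x : ℝ) :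
    HasDerivAt (fun x => (1 - x ^ 2) * deriv (legendreP n) x)
      (-((n : ℝ) * (n + 1)) * legendreP n x) x := by
  cases n with
  | zero =>
    have h0 : legendreP 0 = fun _ => 1 := by ext; rw [legendreP]
    simpa [h0] using hasDerivAt_const x (0 : ℝ)
  | succ n =>
    have h1 : (fun x => (1 - x ^ 2) * deriv (legendreP (n + 1)) x) =
        fun x => ((n : ℝ) + 1) * (legendreP n x - x * legendreP (n + 1) x) := by
      ext x
      obtain ⟨h1, h2⟩ := deriv_legendreP_identities n x
      linear_combination h1 - x * h2
    have h2 := (deriv_legendreP_identities n x).2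
    rw [h1]
    refine ((((differentiable_legendreP n x).hasDerivAt).sub
      ((hasDerivAt_id x).mul (differentiable_legendreP (n + 1) x).hasDerivAt)).const_mul
        ((n : ℝ) + 1)).congr_deriv ?_
    simp only [id]
    push_cast
    linear_combination (-((n : ℝ) + 1)) * h2

/-- The Legendre polynomials are eigenfunctions of a symmetric operator with distinct eigenvalues;
there are no boundary terms since `1 - x²` vanishes at `±1`. -/
lemma integral_legendreP_mul_of_ne {m n : ℕ} (hmn : m ≠ n) :
    ∫ x in (-1 : ℝ)..1, legendreP m x * legendreP n x = 0 := by
  have hd : ∀ x : ℝ, HasDerivAt (fun x => ((1 - x ^ 2) * deriv (legendreP m) x) * legendreP n x -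
      ((1 - x ^ 2) * deriv (legendreP n) x) * legendreP m x)
      (((n : ℝ) * (n + 1) - m * (m + 1)) * (legendreP m x * legendreP n x)) x := by
    intro x
    refine (((hasDerivAt_legendreP_equation m x).mul
      (differentiable_legendreP n x).hasDerivAt).sub ((hasDerivAt_legendreP_equation n x).mul
        (differentiable_legendreP m x).hasDerivAt)).congr_deriv ?_
    ring
  have hc := ((continuous_legendreP m).mul (continuous_legendreP n)).const_mul
    ((n : ℝ) * (n + 1) - m * (m + 1))
  have h := intervalIntegral.integral_eq_sub_of_hasDerivAt (a := -1) (b := 1)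
    (fun x _ => hd x) (hc.intervalIntegrable _ _)
  rw [intervalIntegral.integral_const_mul] at h
  norm_num at h
  refine h.resolve_left fun h0 => hmn ?_
  have h1 : ((n : ℝ) - m) * (n + m + 1) = 0 := by linear_combination h0
  rcases mul_eq_zero.1 h1 with h2 | h2
  · exact_mod_cast (sub_eq_zero.1 h2).symm
  · exact absurd h2 (by positivity)

lemma integral_legendreP_mul_self_pos (n : ℕ) :
    0 < ∫ x in (-1 : ℝ)..1, legendreP n x * legendreP n x :=
  intervalIntegral.integral_pos (by norm_num)
    ((continuous_legendreP n).mul (continuous_legendreP n)).continuousOn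
    (fun x _ => mul_self_nonneg _) ⟨1, by simp, by simp [legendreP_one_eq_one]⟩

/-! ### Orthogonality of the Fourier-Legendre polynomials -/

lemma fourierLegendre_eq_prod {Ω : Type*} {ξ : ℕ → Ω → ℝ} {α : MultiIndex} {s : Finset ℕ}
    (hs : α.support ⊆ s) (ω : Ω) :
    fourierLegendre ξ α ω = ∏ i ∈ s, legendreP (α i) (ξ i ω) :=
  Finsupp.prod_of_support_subset α hs _ fun i _ => by rw [legendreP]

section Chaos

variable {Ω : Type*} [MeasurableSpace Ω] {P : Measure Ω} {ξ : ℕ → Ω → ℝ}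

lemma IsUniformSequence.integral_comp (hξ : IsUniformSequence ξ P) {f : ℝ → ℝ}
    (hf : Continuous f) (i : ℕ) :
    ∫ ω, f (ξ i ω) ∂P = 2⁻¹ * ∫ x in (-1 : ℝ)..1, f x := by
  rw [← integral_map (hξ.measurable i).aemeasurable hf.aestronglyMeasurable,
    show Measure.map (ξ i) P = _ from hξ.uniform i, ProbabilityTheory.cond, integral_smul_measure,
    intervalIntegral.integral_of_le (by norm_num), integral_Icc_eq_integral_Ioc]
  norm_num

lemma IsUniformSequence.ae_mem (hξ : IsUniformSequence ξ P) :
    ∀ᵐ ω ∂P, ∀ i, ξ i ω ∈ Icc (-1 : ℝ) 1 := by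
  rw [ae_all_iff]
  intro i
  refine ae_of_ae_map (p := fun x => x ∈ Icc (-1 : ℝ) 1) (hξ.measurable i).aemeasurable ?_
  rw [show Measure.map (ξ i) P = _ from hξ.uniform i]
  exact ProbabilityTheory.ae_cond_mem measurableSet_Icc

lemma measurable_fourierLegendre (hξ : IsUniformSequence ξ P) (α : MultiIndex) :
    Measurable (fourierLegendre ξ α) := by
  unfold fourierLegendre Finsupp.prod
  exact Finset.measurable_fun_prod _ fun i _ =>
    (continuous_legendreP _).measurable.comp (hξ.measurable i)

lemma exists_bound_fourierLegendre (hξ : IsUniformSequence ξ P) (α : MultiIndex) :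
    ∃ C, ∀ᵐ ω ∂P, ‖fourierLegendre ξ α ω‖ ≤ C := by
  choose B hB using fun n => (isCompact_Icc (a := (-1 : ℝ)) (b := 1)).exists_bound_of_continuousOn
    (continuous_legendreP n).continuousOn
  refine ⟨∏ i ∈ α.support, B (α i), ?_⟩
  filter_upwards [hξ.ae_mem] with ω hω
  rw [fourierLegendre, Finsupp.prod, norm_prod]
  exact Finset.prod_le_prod (fun _ _ => norm_nonneg _) fun i _ => hB _ _ (hω i)

lemma integral_fourierLegendre_mul (hξ : IsUniformSequence ξ P) (α β : MultiIndex) :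
    ∫ ω, fourierLegendre ξ α ω * fourierLegendre ξ β ω ∂P =
      ∏ i ∈ α.support ∪ β.support,
        2⁻¹ * ∫ x in (-1 : ℝ)..1, legendreP (α i) x * legendreP (β i) x := by
  set s := α.support ∪ β.support
  have hc : ∀ i, Continuous fun x => legendreP (α i) x * legendreP (β i) x := fun i =>
    (continuous_legendreP _).mul (continuous_legendreP _)
  have h1 : ∀ ω, fourierLegendre ξ α ω * fourierLegendre ξ β ω =
      ∏ i : s, legendreP (α i) (ξ i ω) * legendreP (β i) (ξ i ω) := fun ω => by
    rw [fourierLegendre_eq_prod Finset.subset_union_left,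
      fourierLegendre_eq_prod Finset.subset_union_right, ← Finset.prod_mul_distrib]
    exact (Finset.prod_coe_sort s
      fun i => legendreP (α i) (ξ i ω) * legendreP (β i) (ξ i ω)).symm
  have hind : iIndepFun (fun (i : s) ω => legendreP (α i) (ξ i ω) * legendreP (β i) (ξ i ω)) P :=
    (hξ.indep.precomp Subtype.val_injective).comp
      (fun (i : s) x => legendreP (α i) x * legendreP (β i) x) fun i => (hc i).measurable
  simp_rw [h1]
  rw [hind.integral_fun_prod_eq_prod_integral fun i =>
    ((hc i).measurable.comp (hξ.measurable i)).aestronglyMeasurable]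
  simp_rw [fun i : s => hξ.integral_comp (hc i) i]
  exact Finset.prod_coe_sort s
    fun i => 2⁻¹ * ∫ x in (-1 : ℝ)..1, legendreP (α i) x * legendreP (β i) x

lemma integral_fourierLegendre_mul_of_ne (hξ : IsUniformSequence ξ P) {α β : MultiIndex}
    (hαβ : α ≠ β) : ∫ ω, fourierLegendre ξ α ω * fourierLegendre ξ β ω ∂P = 0 := by
  obtain ⟨i, hi⟩ := Finsupp.ne_iff.1 hαβ
  rw [integral_fourierLegendre_mul hξ]
  refine Finset.prod_eq_zero (i := i) ?_ (by rw [integral_legendreP_mul_of_ne hi, mul_zero])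
  by_contra h
  simp only [Finset.mem_union, Finsupp.mem_support_iff, not_or, not_not] at h
  exact hi (h.1.trans h.2.symm)

lemma secondMoment_pos (hξ : IsUniformSequence ξ P) (α : MultiIndex) :
    0 < secondMoment ξ P α := by
  simp_rw [secondMoment, pow_two]
  rw [integral_fourierLegendre_mul hξ]
  exact Finset.prod_pos fun i _ => mul_pos (by norm_num) (integral_legendreP_mul_self_pos _)

end Chaos

/-! ### Chaos expansions of Hilbert space valued random variables -/

lemma HasChaosExpansion.congr_ae {Ω : Type*} [MeasurableSpace Ω] {P : Measure Ω}
    {ξ : ℕ → Ω → ℝ} {X : Type*} [NormedAddCommGroup X] [NormedSpace ℝ X] {F F' : Ω → X} {f : MultiIndex → X}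
    (hF : HasChaosExpansion ξ P F f) (h : F =ᵐ[P] F') : HasChaosExpansion ξ P F' f := by
  refine ⟨hF.1.ae_eq h, hF.2.congr fun s => eLpNorm_congr_ae ?_⟩
  filter_upwards [h] with ω hω
  rw [hω]

section Expansion

variable {Ω : Type*} [MeasurableSpace Ω] {P : Measure Ω} [IsProbabilityMeasure P]
  {ξ : ℕ → Ω → ℝ}

section Normed

variable {X : Type*} [NormedAddCommGroup X] [NormedSpace ℝ X]

lemma memLp_fourierLegendre_smul (hξ : IsUniformSequence ξ P) (α : MultiIndex) (x : X) :
    MemLp (fun ω => fourierLegendre ξ α ω • x) 2 P := by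
  obtain ⟨C, hC⟩ := exists_bound_fourierLegendre hξ α
  refine MemLp.of_bound
    ((measurable_fourierLegendre hξ α).stronglyMeasurable.smul_const x).aestronglyMeasurable
    (C * ‖x‖) ?_
  filter_upwards [hC] with ω hω
  rw [norm_smul]
  gcongr

/-- The map `x ↦ L_α x` from `X` into `L²(Ω; X)`. -/
def chaosTerm (hξ : IsUniformSequence ξ P) (α : MultiIndex) : X →ₗ[ℝ] Lp X 2 P where
  toFun x := (memLp_fourierLegendre_smul hξ α x).toLp
  map_add' x y := by
    rw [← MemLp.toLp_add]
    exact MemLp.toLp_congr _ _ (Eventually.of_forall fun ω => by simp)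
  map_smul' c x := by
    rw [RingHom.id_apply, ← MemLp.toLp_const_smul]
    exact MemLp.toLp_congr _ _ (Eventually.of_forall fun ω => by simp [smul_comm c])

lemma coeFn_chaosTerm (hξ : IsUniformSequence ξ P) (α : MultiIndex) (x : X) :
    chaosTerm hξ α x =ᵐ[P] fun ω => fourierLegendre ξ α ω • x :=
  (memLp_fourierLegendre_smul hξ α x).coeFn_toLp

/-- A chaos expansion is an unconditionally convergent series in `L²(Ω; X)`. -/
lemma hasChaosExpansion_iff_hasSum (hξ : IsUniformSequence ξ P) {F : Ω → X}
    {f : MultiIndex → X} (hF : MemLp F 2 P) :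
    HasChaosExpansion ξ P F f ↔ HasSum (fun α => chaosTerm hξ α (f α)) (hF.toLp F) := by
  rw [HasChaosExpansion, and_iff_right hF, HasSum, SummationFilter.unconditional_filter,
    Lp.tendsto_Lp_iff_tendsto_eLpNorm]
  refine tendsto_congr fun s => ?_
  rw [← eLpNorm_neg]
  refine eLpNorm_congr_ae ?_
  have h : ∀ᵐ ω ∂P, ∀ α ∈ s, chaosTerm hξ α (f α) ω = fourierLegendre ξ α ω • f α :=
    (ae_ball_iff s.countable_toSet).2 fun α _ => coeFn_chaosTerm hξ α (f α)
  filter_upwards [Lp.coeFn_finsetSum s fun α => chaosTerm hξ α (f α), h] with ω h1 h2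
  simp only [Pi.neg_apply, Pi.sub_apply, neg_sub, h1, Finset.sum_apply]
  rw [Finset.sum_congr rfl h2]

lemma HasChaosExpansion.hasSum (hξ : IsUniformSequence ξ P) {F : Ω → X} {f : MultiIndex → X}
    (hF : HasChaosExpansion ξ P F f) : HasSum (fun α => chaosTerm hξ α (f α)) (hF.1.toLp F) :=
  (hasChaosExpansion_iff_hasSum hξ hF.1).1 hF

lemma HasChaosExpansion.ae_eq (hξ : IsUniformSequence ξ P) {F F' : Ω → X} {f : MultiIndex → X}
    (hF : HasChaosExpansion ξ P F f) (hF' : HasChaosExpansion ξ P F' f) : F =ᵐ[P] F' :=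
  (MemLp.toLp_eq_toLp_iff hF.1 hF'.1).1 ((hF.hasSum hξ).unique (hF'.hasSum hξ))

lemma HasChaosExpansion.sub (hξ : IsUniformSequence ξ P) {F G : Ω → X} {f g : MultiIndex → X}
    (hF : HasChaosExpansion ξ P F f) (hG : HasChaosExpansion ξ P G g) :
    HasChaosExpansion ξ P (fun ω => F ω - G ω) fun α => f α - g α := by
  refine (hasChaosExpansion_iff_hasSum hξ (hF.1.sub hG.1)).2 ?_
  rw [MemLp.toLp_sub]
  simpa only [map_sub] using (hF.hasSum hξ).sub (hG.hasSum hξ)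

lemma HasChaosExpansion.add (hξ : IsUniformSequence ξ P) {F G : Ω → X} {f g : MultiIndex → X}
    (hF : HasChaosExpansion ξ P F f) (hG : HasChaosExpansion ξ P G g) :
    HasChaosExpansion ξ P (fun ω => F ω + G ω) fun α => f α + g α := by
  refine (hasChaosExpansion_iff_hasSum hξ (hF.1.add hG.1)).2 ?_
  rw [MemLp.toLp_add]
  simpa only [map_add] using (hF.hasSum hξ).add (hG.hasSum hξ)

end Normed

section Hilbert

variable {X : Type*} [NormedAddCommGroup X] [InnerProductSpace ℝ X]

lemma inner_chaosTerm (hξ : IsUniformSequence ξ P) (α β : MultiIndex) (x y : X) :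
    inner ℝ (chaosTerm hξ α x) (chaosTerm hξ β y) =
      (∫ ω, fourierLegendre ξ α ω * fourierLegendre ξ β ω ∂P) * inner ℝ x y := by
  rw [L2.inner_def, ← integral_mul_const]
  refine integral_congr_ae ?_
  filter_upwards [coeFn_chaosTerm hξ α x, coeFn_chaosTerm hξ β y] with ω h1 h2
  rw [h1, h2, real_inner_smul_left, real_inner_smul_right, mul_assoc]

lemma inner_chaosTerm_of_ne (hξ : IsUniformSequence ξ P) {α β : MultiIndex} (h : α ≠ β)
    (x y : X) : inner ℝ (chaosTerm hξ α x) (chaosTerm hξ β y) = 0 := by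
  rw [inner_chaosTerm, integral_fourierLegendre_mul_of_ne hξ h, zero_mul]

lemma inner_chaosTerm_self (hξ : IsUniformSequence ξ P) (α : MultiIndex) (x y : X) :
    inner ℝ (chaosTerm hξ α x) (chaosTerm hξ α y) = secondMoment ξ P α * inner ℝ x y := by
  simp_rw [inner_chaosTerm, secondMoment, pow_two]

/-- The normalized map `x ↦ (𝔼 L_α²)^{-1/2} L_α x`, an isometric embedding of `X`. -/
def chaosIsometry (hξ : IsUniformSequence ξ P) (α : MultiIndex) : X →ₗᵢ[ℝ] Lp X 2 P where
  toLinearMap := (√(secondMoment ξ P α))⁻¹ • chaosTerm hξ α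
  norm_map' x := by
    have h := secondMoment_pos hξ α
    have h1 : ‖chaosTerm hξ α x‖ ^ 2 = (√(secondMoment ξ P α) * ‖x‖) ^ 2 := by
      rw [← real_inner_self_eq_norm_sq, inner_chaosTerm_self, real_inner_self_eq_norm_sq, mul_pow,
        Real.sq_sqrt h.le]
    have h2 := (sq_eq_sq₀ (norm_nonneg _) (by positivity)).1 h1
    have h3 : 0 < √(secondMoment ξ P α) := Real.sqrt_pos.2 h
    rw [LinearMap.smul_apply, norm_smul, h2, norm_inv, Real.norm_of_nonneg h3.le,
      inv_mul_cancel_left₀ h3.ne']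

lemma chaosIsometry_apply (hξ : IsUniformSequence ξ P) (α : MultiIndex) (x : X) :
    chaosIsometry hξ α x = (√(secondMoment ξ P α))⁻¹ • chaosTerm hξ α x := rfl

lemma orthogonalFamily_chaosIsometry (hξ : IsUniformSequence ξ P) :
    OrthogonalFamily ℝ (fun _ : MultiIndex => X) (chaosIsometry hξ) := by
  intro α β h x y
  simp only [chaosIsometry_apply]
  rw [real_inner_smul_left, real_inner_smul_right, inner_chaosTerm_of_ne hξ h, mul_zero, mul_zero]

/-- Square summable coefficients are those of a square integrable random variable. -/
lemma MemX.exists_hasChaosExpansion [CompleteSpace X] (hξ : IsUniformSequence ξ P)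
    {f : MultiIndex → X} (hf : MemX (secondMoment ξ P) f) : ∃ F, HasChaosExpansion ξ P F f := by
  have h1 : Summable fun α => chaosIsometry hξ α (√(secondMoment ξ P α) • f α) := by
    rw [(orthogonalFamily_chaosIsometry hξ).summable_iff_norm_sq_summable]
    refine hf.congr fun α => ?_
    rw [norm_smul, mul_pow, Real.norm_of_nonneg (Real.sqrt_nonneg _),
      Real.sq_sqrt (secondMoment_pos hξ α).le, mul_comm]
  have h2 : Summable fun α => chaosTerm hξ α (f α) := by
    refine h1.congr fun α => ?_
    rw [chaosIsometry_apply, map_smul,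
      inv_smul_smul₀ (Real.sqrt_pos.2 (secondMoment_pos hξ α)).ne']
  obtain ⟨F, hF⟩ := h2
  refine ⟨F, (hasChaosExpansion_iff_hasSum hξ (Lp.memLp F)).2 ?_⟩
  rwa [Lp.toLp_coeFn]

/-- The coefficients of a chaos expansion are unique: `⟨x, f_α⟩ 𝔼 L_α²` is the inner product of
`L_α x` with the sum, and `𝔼 L_α² ≠ 0`. -/
lemma HasChaosExpansion.coeff_unique (hξ : IsUniformSequence ξ P) {F : Ω → X}
    {f f' : MultiIndex → X} (hf : HasChaosExpansion ξ P F f) (hf' : HasChaosExpansion ξ P F f')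
    (α : MultiIndex) : f α = f' α := by
  have key : ∀ {g : MultiIndex → X} {v : Lp X 2 P}, HasSum (fun β => chaosTerm hξ β (g β)) v →
      ∀ x : X, inner ℝ (chaosTerm hξ α x) v = secondMoment ξ P α * inner ℝ x (g α) := by
    intro g v hv x
    have h1 := hv.mapL (innerSL ℝ (chaosTerm hξ α x))
    have h2 := hasSum_single (f := fun β => innerSL ℝ (chaosTerm hξ α x) (chaosTerm hξ β (g β))) α
      fun β hβ => inner_chaosTerm_of_ne hξ hβ.symm _ _
    exact (h1.unique h2).trans (inner_chaosTerm_self hξ α x (g α))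
  refine ext_inner_left ℝ fun x => mul_left_cancel₀ (secondMoment_pos hξ α).ne' ?_
  rw [← key (hf.hasSum hξ), ← key (hf'.hasSum hξ)]

lemma ProcHasChaosExpansion.coeff_eqOn (hξ : IsUniformSequence ξ P) {J : Set ℝ} {U : ℝ → Ω → X}
    {u v : MultiIndex → ℝ → X} (hu : ProcHasChaosExpansion ξ P J U u)
    (hv : ProcHasChaosExpansion ξ P J U v) (α : MultiIndex) : EqOn (u α) (v α) J :=
  fun t ht => (hu t ht).coeff_unique hξ (hv t ht) α

/-! ### The Cauchy problem for Hilbert space valued processes -/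

variable {T : ℝ} {S : ℝ → X →L[ℝ] X} {M w : ℝ} {𝓛 : X →ₗ.[ℝ] X}
  {u₀ : MultiIndex → X} {g : MultiIndex → ℝ → X} {U₀ : Ω → X} {G : ℝ → Ω → X}

/-- A process whose coefficients satisfy the equation satisfies it almost surely. -/
lemma SatisfiesAt.procSatisfiesAt [CompleteSpace X] (hξ : IsUniformSequence ξ P) (hT : 0 < T) {U : ℝ → Ω → X}
    {u : MultiIndex → ℝ → X} (hu : MemC1 (secondMoment ξ P) T u)
    (hU : ProcHasChaosExpansion ξ P (Icc 0 T) U u)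
    (hG : ProcHasChaosExpansion ξ P (Icc 0 T) G g) {t : ℝ} (ht : t ∈ Icc 0 T)
    (h : SatisfiesAt 𝓛 T g u t) : ProcSatisfiesAt ξ P 𝓛 T G U t := by
  obtain ⟨V, hV⟩ := MemX.exists_hasChaosExpansion hξ
    (hu.memX_timeDeriv (fun α => (secondMoment_pos hξ α).le) hT ht)
  refine ⟨V, fun ω => V ω - G t ω,
    ⟨u, hU, fun α => (hu.1 α).differentiableOn one_ne_zero t ht, hV⟩,
    ⟨_, _, hU t ht, h, hV.sub hξ (hG t ht)⟩, Eventually.of_forall fun ω => (sub_add_cancel _ _).symm⟩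

/-- Conversely, the coefficients of a process that satisfies the equation satisfy it, because the
coefficients of the processes and random variables involved are unique. -/
lemma ProcSatisfiesAt.satisfiesAt (hξ : IsUniformSequence ξ P) {U : ℝ → Ω → X}
    {u : MultiIndex → ℝ → X} (hU : ProcHasChaosExpansion ξ P (Icc 0 T) U u)
    (hG : ProcHasChaosExpansion ξ P (Icc 0 T) G g) {t : ℝ} (ht : t ∈ Icc 0 T)
    (h : ProcSatisfiesAt ξ P 𝓛 T G U t) :
    SatisfiesAt 𝓛 T g u t ∧ ∀ α, DifferentiableWithinAt ℝ (u α) (Icc 0 T) t := by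
  obtain ⟨V, H, ⟨v, hv, hvd, hV⟩, ⟨f, h, hf, hfh, hH⟩, hVH⟩ := h
  have huv := hU.coeff_eqOn hξ hv
  refine ⟨fun α => ?_, fun α => (hvd α).congr (huv α) (huv α ht)⟩
  have h1 : timeDeriv T (u α) t = timeDeriv T (v α) t := derivWithin_congr (huv α) (huv α ht)
  have h2 : u α t = f α := (hU t ht).coeff_unique hξ hf α
  have h3 : timeDeriv T (v α) t = h α + g α t :=
    (hV.congr_ae hVH).coeff_unique hξ (hH.add hξ (hG t ht)) α
  rw [h1, h2, h3, add_sub_cancel_right]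
  exact hfh α

/-- Existence and uniqueness for processes, by transfer from the coefficients. -/
lemma exists_isProcClassicalSolution [CompleteSpace X] (hξ : IsUniformSequence ξ P)
    (hT : 0 < T) (hS : IsC0Semigroup S) (h_gen : IsGenerator 𝓛 S) (hM : IsOfType S M w)
    {u : MultiIndex → ℝ → X} (hu : MemC1 (secondMoment ξ P) T u) (hu0 : ∀ α, u α 0 = u₀ α)
    (heq : ∀ t ∈ Icc 0 T, SatisfiesAt 𝓛 T g u t) (hU₀ : HasChaosExpansion ξ P U₀ u₀)
    (hG : ProcHasChaosExpansion ξ P (Icc 0 T) G g) :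
    ∃ U : ℝ → Ω → X, IsProcClassicalSolution ξ P 𝓛 T U₀ G U ∧ ProcMemC1 ξ P T U ∧
      (∀ t ∈ Icc 0 T, ProcSatisfiesAt ξ P 𝓛 T G U t) ∧
      ProcHasChaosExpansion ξ P (Icc 0 T) U u ∧
      ∀ V, IsProcClassicalSolution ξ P 𝓛 T U₀ G V → ∀ t ∈ Icc 0 T, ∀ᵐ ω ∂P, V t ω = U t ω := by
  have hϖ : ∀ α, 0 ≤ secondMoment ξ P α := fun α => (secondMoment_pos hξ α).le
  have hex : ∀ t, ∃ F : Ω → X, t ∈ Icc 0 T → HasChaosExpansion ξ P F fun α => u α t := fun t => by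
    by_cases ht : t ∈ Icc 0 T
    · obtain ⟨F, hF⟩ := MemX.exists_hasChaosExpansion hξ ((hu.memC hϖ).memX hϖ ht)
      exact ⟨F, fun _ => hF⟩
    · exact ⟨0, fun h => absurd h ht⟩
  choose U hU using hex
  have hU' : ProcHasChaosExpansion ξ P (Icc 0 T) U u := hU
  have h0 : (0 : ℝ) ∈ Icc 0 T := ⟨le_rfl, hT.le⟩
  have hUeq : ∀ t ∈ Icc 0 T, ProcSatisfiesAt ξ P 𝓛 T G U t := fun t ht =>
    (heq t ht).procSatisfiesAt hξ hT hu hU' hG ht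
  refine ⟨U, ⟨⟨u, hu.memC hϖ, hU'⟩, ⟨u, hu.memC1Ioc hϖ hT, fun t ht => hU t ⟨ht.1.le, ht.2⟩⟩, ?_,
    fun t ht => hUeq t ⟨ht.1.le, ht.2⟩⟩, ⟨u, hu, hU'⟩, hUeq, hU', fun V hV t ht => ?_⟩
  · have h := hU 0 h0
    simp only [hu0] at h
    exact h.ae_eq hξ hU₀
  · obtain ⟨v, hvC, hVv⟩ := hV.memC
    have hv : ∀ s ∈ Ioc 0 T, SatisfiesAt 𝓛 T g v s ∧
        ∀ α, DifferentiableWithinAt ℝ (v α) (Icc 0 T) s := fun s hs =>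
      (hV.equation s hs).satisfiesAt hξ hVv hG ⟨hs.1.le, hs.2⟩
    have hvu : ∀ α, v α t = u α t := fun α => by
      refine eqOn_of_isSolution hS hM h_gen (g := g α) (hvC.1 α) (hu.1 α).continuousOn ?_
        (fun s hs => (hv s hs).2 α)
        (fun s hs => (hu.1 α).differentiableOn one_ne_zero s ⟨hs.1.le, hs.2⟩)
        (fun s hs => (hv s hs).1 α) (fun s hs => heq s ⟨hs.1.le, hs.2⟩ α) ht
      rw [hu0]
      exact ((hVv 0 h0).congr_ae hV.initial).coeff_unique hξ hU₀ α
    have h := hVv t ht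
    simp only [hvu] at h
    exact h.ae_eq hξ (hU t ht)

end Hilbert

end Expansion

end ChaosCauchy

end

theorem theorem3p1 {Ω : Type*} [MeasurableSpace Ω] (P : Measure Ω) [IsProbabilityMeasure P]
    (ξ : ℕ → Ω → ℝ) (hξ : ChaosCauchy.IsUniformSequence ξ P)
    {X : Type*} [NormedAddCommGroup X] [NormedSpace ℝ X] [CompleteSpace X]
    (T : ℝ) (hT : 0 < T)
    -- the operator generates a semigroup of type `(M, w)`
    (𝓛 : X →ₗ.[ℝ] X) (h_dense : Dense (𝓛.domain : Set X))
    (S : ℝ → X →L[ℝ] X) (hS : ChaosCauchy.IsC0Semigroup S) (h_gen : ChaosCauchy.IsGenerator 𝓛 S)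
    (M w : ℝ) (h_type : ChaosCauchy.IsOfType S M w)
    -- the initial value
    (u₀ : ChaosCauchy.MultiIndex → X)
    (hu₀ : ChaosCauchy.MemX (ChaosCauchy.secondMoment ξ P) u₀)
    (hu₀_dom : ∀ α, u₀ α ∈ 𝓛.domain)
    (hLu₀ : ChaosCauchy.MemX (ChaosCauchy.secondMoment ξ P) (fun α => 𝓛 ⟨u₀ α, hu₀_dom α⟩))
    -- the noise
    (g : ChaosCauchy.MultiIndex → ℝ → X)
    (hg : ChaosCauchy.MemC1 (ChaosCauchy.secondMoment ξ P) T g) :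
    -- chaos expansions with coefficients in the Banach space `X`
    (ChaosCauchy.IsClassicalSolution (ChaosCauchy.secondMoment ξ P) 𝓛 T u₀ g
        (ChaosCauchy.variationOfConstants S u₀ g) ∧
      ChaosCauchy.MemC1 (ChaosCauchy.secondMoment ξ P) T
        (ChaosCauchy.variationOfConstants S u₀ g) ∧
      (∀ t ∈ Icc 0 T,
        ChaosCauchy.SatisfiesAt 𝓛 T g (ChaosCauchy.variationOfConstants S u₀ g) t) ∧
      ∀ v, ChaosCauchy.IsClassicalSolution (ChaosCauchy.secondMoment ξ P) 𝓛 T u₀ g v →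
        ∀ α, ∀ t ∈ Icc 0 T, v α t = ChaosCauchy.variationOfConstants S u₀ g α t) ∧
    -- `X`-valued processes, when `X` is a Hilbert space
    (InnerProductSpaceable X →
      ∀ (U₀ : Ω → X) (G : ℝ → Ω → X), ChaosCauchy.HasChaosExpansion ξ P U₀ u₀ →
        ChaosCauchy.ProcHasChaosExpansion ξ P (Icc 0 T) G g →
        ∃ U : ℝ → Ω → X,
          ChaosCauchy.IsProcClassicalSolution ξ P 𝓛 T U₀ G U ∧
          ChaosCauchy.ProcMemC1 ξ P T U ∧
          (∀ t ∈ Icc 0 T, ChaosCauchy.ProcSatisfiesAt ξ P 𝓛 T G U t) ∧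
          ChaosCauchy.ProcHasChaosExpansion ξ P (Icc 0 T) U
            (ChaosCauchy.variationOfConstants S u₀ g) ∧
          ∀ V, ChaosCauchy.IsProcClassicalSolution ξ P 𝓛 T U₀ G V →
            ∀ t ∈ Icc 0 T, ∀ᵐ ω ∂P, V t ω = U t ω) := by
  have hϖ : ∀ α, 0 ≤ ChaosCauchy.secondMoment ξ P α :=
    fun α => (ChaosCauchy.secondMoment_pos hξ α).le
  obtain ⟨hC1, heq⟩ := ChaosCauchy.memC1_and_satisfiesAt_variationOfConstants hϖ hT hS h_gen h_type
    hu₀ hLu₀ (fun α => 𝓛.mem_graph ⟨u₀ α, hu₀_dom α⟩) hg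
  have h0 : ∀ α, ChaosCauchy.variationOfConstants S u₀ g α 0 = u₀ α := fun α => by
    simp [ChaosCauchy.variationOfConstants, hS.zero]
  have hd : ∀ α, ∀ t ∈ Ioc 0 T, DifferentiableWithinAt ℝ
      (ChaosCauchy.variationOfConstants S u₀ g α) (Icc 0 T) t := fun α t ht =>
    (hC1.1 α).differentiableOn one_ne_zero t (Ioc_subset_Icc_self ht)
  refine ⟨⟨⟨hC1.memC hϖ, hC1.memC1Ioc hϖ hT, h0, fun t ht => heq t (Ioc_subset_Icc_self ht)⟩,
    hC1, heq, fun v hv α => ?_⟩, fun hX U₀ G hU₀ hG => ?_⟩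
  · refine ChaosCauchy.eqOn_of_isSolution hS h_type h_gen (g := g α) (hv.memC.1 α)
      (hC1.1 α).continuousOn ((hv.initial α).trans (h0 α).symm) (fun t ht => ?_) (hd α)
      (fun t ht => hv.equation t ht α) (fun t ht => heq t (Ioc_subset_Icc_self ht) α)
    -- Near `t > 0` the intervals `(0, T]` and `[0, T]` have the same neighbourhoods.
    have h1 := (hv.memC1.1 α).differentiableOn one_ne_zero t ht
    refine h1.mono_of_mem_nhdsWithin ?_
    filter_upwards [self_mem_nhdsWithin, mem_nhdsWithin_of_mem_nhds (lt_mem_nhds ht.1)]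
      with s hs hs0
    exact ⟨hs0, hs.2⟩
  · let : InnerProductSpace ℝ X := InnerProductSpace.ofNorm ℝ hX.parallelogram_identity
    exact ChaosCauchy.exists_isProcClassicalSolution hξ hT hS h_gen h_type hC1 h0 heq hU₀ hG
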